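/- Let $M$ be a smooth Riemannian $3$-manifold with Levi-Civita connection $\nabla$, and let $\Sigma$ be a connected smooth surface immersed in $M$ with a smooth unit normal vector field $\mathcal N$. Let $\mathcal V$ be a smooth unit vector field of $M$ along $\Sigma$ and let $\theta:\Sigma\to[0,\frac{\pi}{2}]$ be a smooth function with $\langle\mathcal V,\mathcal N\rangle=\cos\theta$ (so $\Sigma$ is a prescribed angle (PA) surface with $(\mathcal V,\theta)$). Assume that * $\mathcal V$ is anti-torqued along $\Sigma$ with potential function $f$, that is, $f:\Sigma\to\mathbb R$ is smooth and $\nabla_X\mathcal V=f\,(X-\langle X,\mathcal V\rangle\mathcal V)$ for all $X$ tangent to $\Sigma$; * $\Sigma$ is totally geodesic, that is, its shape operator $A(X)=-\nabla_X\mathcal N$ vanishes; * $\theta$ is not constant. Then around every point $p\in\Sigma$ with $\theta(p)\neq 0$ there is a local coordinate system $(u,v)$ of $\Sigma$, with $u$ ranging over an open interval $J$, in which $f=f(u)$ and $\theta=\theta(u)$ depend only on $u$ and $$\theta(u)=\arccos\big(\operatorname{sech}F(u)\big),\qquad K_{\mathrm{int}}=-\big(F''(u)\coth F(u)+F'(u)^2\big),$$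 where $F(u)=\int_{u_0}^u f(t)\,dt+c$ for some $u_0\in J$ and $c\in\mathbb R$, $F$ has no zero on $J$, and $K_{\mathrm{int}}$ is the intrinsic (Gauss) curvature of the metric induced on $\Sigma$. -/

import Mathlib

open scoped Manifold ContDiff Topology Bundle

noncomputable section

namespace PASurface

/-- The coordinate space `ℝⁿ` with its Euclidean norm. -/
abbrev E (n : ℕ) : Type := EuclideanSpace ℝ (Fin n)

/-! ### Curvature of a metric given in coordinates -/

section Coordinates

variable {n : ℕ}

/-- The partial derivative `∂ᵢ h` at `y`. -/
def pd (i : Fin n) (h : E n → ℝ) (y : E n) : ℝ :=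
  fderiv ℝ h y (EuclideanSpace.single i 1)

/-- The Christoffel symbol `Γᵏᵢⱼ = ½ ∑ₗ gᵏˡ (∂ᵢ gⱼₗ + ∂ⱼ gᵢₗ - ∂ₗ gᵢⱼ)` of the metric with
coefficients `g`. -/
def christoffel (g : E n → Matrix (Fin n) (Fin n) ℝ) (k i j : Fin n) (y : E n) : ℝ :=
  (1 / 2) * ∑ l, (g y)⁻¹ k l *
    (pd i (fun z => g z j l) y + pd j (fun z => g z i l) y - pd l (fun z => g z i j) y)

/-- The `l`-th component of `R(∂ᵢ, ∂ⱼ)∂ₖ`, where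
`R(X, Y)Z = ∇_X ∇_Y Z - ∇_Y ∇_X Z - ∇_[X,Y] Z` for the Levi-Civita connection of `g`. -/
def curvatureTensor (g : E n → Matrix (Fin n) (Fin n) ℝ) (l i j k : Fin n) (y : E n) : ℝ :=
  pd i (christoffel g l j k) y - pd j (christoffel g l i k) y
    + ∑ m, (christoffel g m j k y * christoffel g l i m y
      - christoffel g m i k y * christoffel g l j m y)

/-- The curvature `⟨R(∂₀, ∂₁)∂₁, ∂₀⟩ / (g₀₀ g₁₁ - g₀₁²)` of a two-dimensional metric `g`. -/
def gaussCurvature (g : E 2 → Matrix (Fin 2) (Fin 2) ℝ) (y : E 2) : ℝ :=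
  (∑ l, curvatureTensor g l 0 1 1 y * g y l 0) / (g y 0 0 * g y 1 1 - g y 0 1 ^ 2)

end Coordinates

/-! ### Surfaces in a Riemannian three-manifold -/

section Surfaces

variable {M : Type*} [TopologicalSpace M] [ChartedSpace (E 3) M] [IsManifold (𝓡 3) ∞ M]
  [Bundle.RiemannianBundle (fun x : M => TangentSpace (𝓡 3) x)]
  [IsContMDiffRiemannianBundle (𝓡 3) ∞ (E 3) (fun x : M => TangentSpace (𝓡 3) x)]

/-- A smooth metric is in particular of class `C¹`. -/
theorem isContMDiffRiemannianBundle_one :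
    IsContMDiffRiemannianBundle (𝓡 3) 1 (E 3) (fun x : M => TangentSpace (𝓡 3) x) :=
  IsContMDiffRiemannianBundle.of_le (n := ∞) (by exact_mod_cast le_top)

/-- A covariant derivative on the tangent bundle is the Levi-Civita connection if it is
torsion-free and compatible with the metric. -/
def IsLeviCivita
    (nabla : CovariantDerivative (𝓡 3) (E 3) (fun x : M => TangentSpace (𝓡 3) x)) : Prop :=
  haveI : IsContMDiffRiemannianBundle (𝓡 3) 1 (E 3) (fun x : M => TangentSpace (𝓡 3) x) :=
    isContMDiffRiemannianBundle_one
  nabla.torsion = 0 ∧ nabla.IsMetricCompatible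

variable {S : Type*} [TopologicalSpace S] [ChartedSpace (E 2) S]

/-- `W` is a smooth section of the pulled back tangent bundle, that is, a smooth vector field of
`M` along the map `ι : S → M`. -/
def IsSmoothAlong (ι : S → M) (W : (p : S) → TangentSpace (𝓡 3) (ι p)) : Prop :=
  ContMDiff (𝓡 2) (𝓡 3).tangent ∞ (fun p => (⟨ι p, W p⟩ : TangentBundle (𝓡 3) M))

/-- The covariant derivative `X ↦ ∇_X W` at `p` of a vector field `W` along an immersion `ι` is
`D`. It is computed with a smooth local extension of `W` to the ambient manifold; for an immersion
and a smooth `W` an extension exists and the result does not depend on its choice. -/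
def HasCovDerivAlong
    (nabla : CovariantDerivative (𝓡 3) (E 3) (fun x : M => TangentSpace (𝓡 3) x))
    (ι : S → M) (W : (p : S) → TangentSpace (𝓡 3) (ι p)) (p : S)
    (D : TangentSpace (𝓡 2) p → TangentSpace (𝓡 3) (ι p)) : Prop :=
  ∃ W' : (x : M) → TangentSpace (𝓡 3) x,
    ContMDiffAt (𝓡 3) (𝓡 3).tangent ∞
      (fun x => (⟨x, W' x⟩ : TangentBundle (𝓡 3) M)) (ι p) ∧
    (∀ᶠ q in 𝓝 p, W' (ι q) = W q) ∧
    ∀ X : TangentSpace (𝓡 2) p, nabla W' (ι p) (mfderiv (𝓡 2) (𝓡 3) ι p X) = D X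

/-- `N` is a smooth unit normal vector field along `ι`. -/
structure IsUnitNormal (ι : S → M) (N : (p : S) → TangentSpace (𝓡 3) (ι p)) : Prop where
  smooth : IsSmoothAlong ι N
  norm_eq_one : ∀ p, ‖N p‖ = 1
  orthogonal : ∀ (p : S) (X : TangentSpace (𝓡 2) p),
    inner ℝ (N p) (mfderiv (𝓡 2) (𝓡 3) ι p X) = 0

/-- The immersed surface `ι` with unit normal `N` is a prescribed angle surface with `(V, θ)`. -/
structure IsPrescribedAngle (ι : S → M) (N V : (p : S) → TangentSpace (𝓡 3) (ι p))
    (θ : S → ℝ) : Prop where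
  smooth_field : IsSmoothAlong ι V
  norm_eq_one : ∀ p, ‖V p‖ = 1
  smooth_angle : ContMDiff (𝓡 2) 𝓘(ℝ, ℝ) ∞ θ
  angle_mem : ∀ p, θ p ∈ Set.Icc 0 (Real.pi / 2)
  inner_eq : ∀ p, inner ℝ (V p) (N p) = Real.cos (θ p)

/-- The unit field `V` is anti-torqued along `ι` with potential function `f`:
`∇_X V = f (X - ⟨X, V⟩ V)` for all `X` tangent to the surface. -/
structure IsAntiTorquedAlong
    (nabla : CovariantDerivative (𝓡 3) (E 3) (fun x : M => TangentSpace (𝓡 3) x))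
    (ι : S → M) (V : (p : S) → TangentSpace (𝓡 3) (ι p)) (f : S → ℝ) : Prop where
  smooth_potential : ContMDiff (𝓡 2) 𝓘(ℝ, ℝ) ∞ f
  covDeriv_eq : ∀ p, HasCovDerivAlong nabla ι V p (fun X =>
    f p • (mfderiv (𝓡 2) (𝓡 3) ι p X
      - (inner ℝ (mfderiv (𝓡 2) (𝓡 3) ι p X) (V p) : ℝ) • V p))

/-- `A` is the shape operator at `p`: `∇_X N = - A X`. -/
def IsShapeOperatorAt
    (nabla : CovariantDerivative (𝓡 3) (E 3) (fun x : M => TangentSpace (𝓡 3) x))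
    (ι : S → M) (N : (p : S) → TangentSpace (𝓡 3) (ι p)) (p : S)
    (A : TangentSpace (𝓡 2) p →L[ℝ] TangentSpace (𝓡 2) p) : Prop :=
  HasCovDerivAlong nabla ι N p (fun X => - mfderiv (𝓡 2) (𝓡 3) ι p (A X))

/-- The surface is totally geodesic: its shape operator vanishes. -/
def IsTotallyGeodesic
    (nabla : CovariantDerivative (𝓡 3) (E 3) (fun x : M => TangentSpace (𝓡 3) x))
    (ι : S → M) (N : (p : S) → TangentSpace (𝓡 3) (ι p)) : Prop :=
  ∀ p, IsShapeOperatorAt nabla ι N p 0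

/-- The coefficients `⟨∂ᵢ, ∂ⱼ⟩` of the induced metric of the immersed surface `ι` in the
coordinates `e`, as functions on the coordinate domain. -/
def inducedMetric (ι : S → M) (e : OpenPartialHomeomorph S (E 2)) (y : E 2) :
    Matrix (Fin 2) (Fin 2) ℝ :=
  Matrix.of fun i j =>
    inner ℝ (mfderiv (𝓡 2) (𝓡 3) (ι ∘ e.symm) y (EuclideanSpace.single i (1 : ℝ)))
      (mfderiv (𝓡 2) (𝓡 3) (ι ∘ e.symm) y (EuclideanSpace.single j (1 : ℝ)))

/-- The intrinsic curvature at `q` of the immersed surface `ι`, computed from the induced metric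
in the coordinates `e` around `q`. -/
def intrinsicCurvature (ι : S → M) (e : OpenPartialHomeomorph S (E 2)) (q : S) : ℝ :=
  gaussCurvature (inducedMetric ι e) (e q)

end Surfaces

/-- The hyperbolic secant. -/
def sech (x : ℝ) : ℝ := 1 / Real.cosh x

/-- The hyperbolic cotangent, meaningful for `x ≠ 0`. -/
def coth (x : ℝ) : ℝ := Real.cosh x / Real.sinh x

end PASurface

end

/-! Everything reduces to two one-forms on the surface: `α = ⟨V, ·⟩` and `β = ⟨U, ·⟩`, where `U` is
a local unit tangent field orthogonal to `V`. Where `sin θ > 0`, the tangential part of `V` has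
length `sin θ`, so the induced metric is `α² / sin² θ + β²`.

Since `N` is parallel along the surface, the anti-torqued equation gives `d(cos θ) = -f cos θ α`,
`dα = 0` and `dβ = (f / sin² θ) α ∧ β` (`fderiv_cos_angle`, `fderiv_alongForm_field_comm`,
`fderiv_alongForm_orthogonal_sub`). The first is a linear equation for `cos θ`, so its zero set is
open as well as closed; as `θ` is not constant, connectedness gives `cos θ > 0` everywhere
(`cos_angle_pos`).

Now `dθ = f cot θ α`, hence `α / sin θ` and `cot θ β` are closed. Their primitives `u`, `v` are
coordinates (`exists_chart_of_closed_coframe`), and the metric becomes `du² + tan² θ dv²`. Put `F =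
arsinh (tan θ)`; then `dF = dθ / cos θ = f du`. So `F` and `f` depend on `u` alone, `F' = f`, `cosh
F = 1 / cos θ` and `sinh F = tan θ`. The curvature `-w'' / w` of `du² + w(u)² dv²` with `w = sinh F`
is the claimed one (`gaussCurvature_warpedMetric_sinh`). -/

noncomputable section

namespace PASurface

/-! ### Constant-coefficient vector fields in an ambient chart -/

section CoordinateFields

variable {M : Type*} [TopologicalSpace M] [ChartedSpace (E 3) M] [IsManifold (𝓡 3) ∞ M]

/-- The vector field with constant coefficients `c` in the chart `ψ`. -/
def coordField (ψ : OpenPartialHomeomorph M (E 3)) (c : E 3) (m : M) : TangentSpace (𝓡 3) m :=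
  VectorField.mpullback (𝓡 3) 𝓘(ℝ, E 3) ψ (fun _ => c) m

variable {ψ : OpenPartialHomeomorph M (E 3)} (hψ : ψ ∈ IsManifold.maximalAtlas (𝓡 3) ∞ M)
include hψ

omit [IsManifold (𝓡 3) ∞ M] in
theorem isInvertible_mfderiv_chart {m : M} (hm : m ∈ ψ.source) :
    (mfderiv (𝓡 3) 𝓘(ℝ, E 3) ψ m).IsInvertible := by
  have hd : ψ.MDifferentiable (𝓡 3) 𝓘(ℝ, E 3) :=
    ⟨(contMDiffOn_of_mem_maximalAtlas hψ).mdifferentiableOn (by simp),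
      (contMDiffOn_symm_of_mem_maximalAtlas hψ).mdifferentiableOn (by simp)⟩
  exact ⟨hd.mfderiv hm, rfl⟩

omit hψ in
theorem contMDiffAt_constField (c y : E 3) :
    ContMDiffAt 𝓘(ℝ, E 3) 𝓘(ℝ, E 3).tangent ∞
      (fun y : E 3 => (⟨y, c⟩ : TangentBundle 𝓘(ℝ, E 3) (E 3))) y := by
  exact (contMDiffAt_vectorSpace_iff_contDiffAt (V := fun _ : E 3 => c)).2 contDiffAt_const

theorem contMDiffAt_coordField (c : E 3) {m : M} (hm : m ∈ ψ.source) :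
    ContMDiffAt (𝓡 3) (𝓡 3).tangent ∞
      (fun x => (⟨x, coordField ψ c x⟩ : TangentBundle (𝓡 3) M)) m := by
  refine ContMDiffAt.mpullback_vectorField_preimage (n := ∞) (contMDiffAt_constField c _) ?_
    (isInvertible_mfderiv_chart hψ hm) ?_
  · exact (contMDiffOn_of_mem_maximalAtlas hψ).contMDiffAt (ψ.open_source.mem_nhds hm)
  · simp

/-- Lie brackets commute with pullback by the chart, and constant fields on `ℝ³` commute. -/
theorem mlieBracket_coordField (c d : E 3) {m : M} (hm : m ∈ ψ.source) :
    VectorField.mlieBracket (𝓡 3) (coordField ψ c) (coordField ψ d) m = 0 := by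
  have : IsManifold (𝓡 3) (minSmoothness ℝ 2) M := by
    rw [minSmoothness_of_isRCLikeNormedField]; infer_instance
  have h := VectorField.mpullback_mlieBracket (I := 𝓡 3) (I' := 𝓘(ℝ, E 3)) (n := ∞)
    (V := fun _ : E 3 => c) (W := fun _ : E 3 => d) (f := ψ) (x₀ := m)
    ((contMDiffAt_constField c _).mdifferentiableAt (by simp))
    ((contMDiffAt_constField d _).mdifferentiableAt (by simp))
    ((contMDiffOn_of_mem_maximalAtlas hψ).contMDiffAt (ψ.open_source.mem_nhds hm))
    (by rw [minSmoothness_of_isRCLikeNormedField]; exact ENat.LEInfty.out)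
  refine h.symm.trans ?_
  have h0 : VectorField.mlieBracket 𝓘(ℝ, E 3) (fun _ : E 3 => c) (fun _ : E 3 => d) (ψ m)
      = (0 : E 3) := by
    have h1 := congrFun (VectorField.mlieBracketWithin_eq_lieBracketWithin (𝕜 := ℝ)
      (V := fun _ : E 3 => c) (W := fun _ : E 3 => d) (s := Set.univ)) (ψ m)
    refine h1.trans ?_
    simp [VectorField.lieBracketWithin]
    rfl
  exact (congrArg _ h0).trans (map_zero _)

variable {j : E 2 → M} {x : E 2} {L : E 2 →L[ℝ] E 3}

-- This turns coordinate tangent vectors of the surface into values of ambient fields, to which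
-- `nabla` can be applied.
omit [IsManifold (𝓡 3) ∞ M] in
theorem mfderiv_eq_coordField (hj : MDifferentiableAt (𝓡 2) (𝓡 3) j x) (hx : j x ∈ ψ.source)
    (h : ∀ᶠ y in 𝓝 x, ψ (j y) = L y) (v : E 2) :
    mfderiv (𝓡 2) (𝓡 3) j x v = coordField ψ (L v) (j x) := by
  have hψd : MDifferentiableAt (𝓡 3) 𝓘(ℝ, E 3) ψ (j x) :=
    ((contMDiffOn_of_mem_maximalAtlas hψ).contMDiffAt
      (ψ.open_source.mem_nhds hx)).mdifferentiableAt (by simp)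
  have h1 : mfderiv (𝓡 2) 𝓘(ℝ, E 3) (ψ ∘ j) x = L := by
    rw [Filter.EventuallyEq.mfderiv_eq (f₁ := ψ ∘ j) (f := L) h, mfderiv_eq_fderiv]
    exact L.fderiv
  have h2 : mfderiv (𝓡 3) 𝓘(ℝ, E 3) ψ (j x) (mfderiv (𝓡 2) (𝓡 3) j x v) = L v := by
    rw [← mfderiv_comp_apply x hψd hj v, h1]
    rfl
  obtain ⟨e, he⟩ := isInvertible_mfderiv_chart hψ hx
  rw [← he] at h2
  change _ = (mfderiv (𝓡 3) 𝓘(ℝ, E 3) ψ (j x)).inverse (L v)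
  rw [← he, ContinuousLinearMap.inverse_equiv, ← h2]
  exact (e.symm_apply_apply _).symm

end CoordinateFields

/-! ### The Levi-Civita connection along a map -/

section Along

variable {M : Type*} [TopologicalSpace M] [ChartedSpace (E 3) M] [IsManifold (𝓡 3) ∞ M]
  [Bundle.RiemannianBundle (fun x : M => TangentSpace (𝓡 3) x)]
  [IsContMDiffRiemannianBundle (𝓡 3) ∞ (E 3) (fun x : M => TangentSpace (𝓡 3) x)]
  {nabla : CovariantDerivative (𝓡 3) (E 3) (fun x : M => TangentSpace (𝓡 3) x)}

/-- A vector field of `M` is differentiable at `m`. -/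
abbrev DiffFieldAt (σ : (x : M) → TangentSpace (𝓡 3) x) (m : M) : Prop :=
  MDifferentiableAt (𝓡 3) (𝓡 3).tangent (fun x => (⟨x, σ x⟩ : TangentBundle (𝓡 3) M)) m

/-- Metric compatibility combined with the chain rule. Agreement of `H` with the inner product is
asked only near `x`, because fields along the surface have only local ambient extensions. -/
theorem IsLeviCivita.fderiv_inner_comp (hnabla : IsLeviCivita nabla) {j : E 2 → M} {x : E 2}
    (hj : MDifferentiableAt (𝓡 2) (𝓡 3) j x) {σ τ : (x : M) → TangentSpace (𝓡 3) x}
    (hσ : DiffFieldAt σ (j x)) (hτ : DiffFieldAt τ (j x)) {H : E 2 → ℝ}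
    (hH : ∀ᶠ y in 𝓝 x, H y = inner ℝ (σ (j y)) (τ (j y))) (v : E 2) :
    fderiv ℝ H x v = inner ℝ (nabla σ (j x) (mfderiv (𝓡 2) (𝓡 3) j x v)) (τ (j x))
      + inner ℝ (σ (j x)) (nabla τ (j x) (mfderiv (𝓡 2) (𝓡 3) j x v)) := by
  have hR : IsContMDiffRiemannianBundle (𝓡 3) 1 (E 3) (fun x : M => TangentSpace (𝓡 3) x) :=
    isContMDiffRiemannianBundle_one
  have hm := hnabla.2
  have h1 := hm.mvfderiv_inner_eq (x := j x)
    (FiberBundle.extend (E 3) (mfderiv (𝓡 2) (𝓡 3) j x v)) hσ hτ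
  have hd : MDifferentiableAt (𝓡 3) 𝓘(ℝ, ℝ) (fun m => (inner ℝ (σ m) (τ m) : ℝ)) (j x) :=
    MDifferentiableAt.inner_bundle hσ hτ
  have h2 := mvfderiv_comp_apply x hd hj v
  simp only [FiberBundle.extend_apply_self] at h1
  rw [Filter.EventuallyEq.fderiv_eq (f₁ := H) (f := fun y => inner ℝ (σ (j y)) (τ (j y))) hH]
  rw [← h1, ← h2]
  rw [mvfderiv, mfderiv_eq_fderiv]
  rfl

theorem IsLeviCivita.nabla_coordField_comm (hnabla : IsLeviCivita nabla)
    {ψ : OpenPartialHomeomorph M (E 3)} (hψ : ψ ∈ IsManifold.maximalAtlas (𝓡 3) ∞ M)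
    {m : M} (hm : m ∈ ψ.source) (c d : E 3) :
    nabla (coordField ψ c) m (coordField ψ d m) = nabla (coordField ψ d) m (coordField ψ c m) := by
  have h := nabla.torsion_eq_zero_iff.1 hnabla.1 (x := m)
    ((contMDiffAt_coordField hψ d hm).mdifferentiableAt (by simp))
    ((contMDiffAt_coordField hψ c hm).mdifferentiableAt (by simp))
  rw [mlieBracket_coordField hψ d c hm] at h
  exact sub_eq_zero.1 h

end Along

/-! ### Orthogonal decomposition in a three-dimensional inner product space -/

section LinearAlgebra

variable {F : Type*} [NormedAddCommGroup F] [InnerProductSpace ℝ F]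

/-- The component of `X` orthogonal to the plane spanned by the unit vectors `V` and `N`, for `X`
orthogonal to `N`. -/
def perp (X V N : F) : F :=
  X - ((inner ℝ X V : ℝ) / (1 - (inner ℝ V N : ℝ) ^ 2)) • (V - (inner ℝ V N : ℝ) • N)

/-- The normalization of `perp X V N`. -/
def unitPerp (X V N : F) : F :=
  (√(inner ℝ (perp X V N) (perp X V N)))⁻¹ • perp X V N

variable {X V N : F} (hV : ‖V‖ = 1) (hN : ‖N‖ = 1) (hVN : (inner ℝ V N : ℝ) ^ 2 < 1)
  (hX : (inner ℝ X N : ℝ) = 0)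

include hN hX in
theorem inner_perp_normal : (inner ℝ (perp X V N) N : ℝ) = 0 := by
  simp [perp, inner_sub_left, inner_smul_left, hX, hN]

include hV hVN in
theorem inner_perp_field : (inner ℝ (perp X V N) V : ℝ) = 0 := by
  have h : (1 - (inner ℝ V N : ℝ) ^ 2) ≠ 0 := by linarith
  simp only [perp, inner_sub_left, inner_smul_left, real_inner_self_eq_norm_sq, hV,
    real_inner_comm V N, RCLike.conj_to_real]
  field_simp
  ring

include hN hX in
theorem inner_unitPerp_normal : (inner ℝ (unitPerp X V N) N : ℝ) = 0 := by
  rw [unitPerp, inner_smul_left, inner_perp_normal hN hX, mul_zero]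

include hV hVN in
theorem inner_unitPerp_field : (inner ℝ (unitPerp X V N) V : ℝ) = 0 := by
  rw [unitPerp, inner_smul_left, inner_perp_field hV hVN, mul_zero]

theorem inner_unitPerp_self (h0 : perp X V N ≠ 0) :
    (inner ℝ (unitPerp X V N) (unitPerp X V N) : ℝ) = 1 := by
  have h : 0 < (inner ℝ (perp X V N) (perp X V N) : ℝ) := real_inner_self_pos.2 h0
  rw [unitPerp, inner_smul_left, inner_smul_right, RCLike.conj_to_real, ← mul_assoc, ← mul_inv,
    Real.mul_self_sqrt h.le, inv_mul_cancel₀ h.ne']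

include hV hN hVN hX in
/-- A vector orthogonal to `N` is a combination of `V - ⟨V, N⟩ N` and of the unit vector `U`
orthogonal to `V` and `N`. -/
theorem eq_smul_add_smul_of_orthogonal (hF : Module.finrank ℝ F = 3) {U : F}
    (hUN : (inner ℝ U N : ℝ) = 0) (hUV : (inner ℝ U V : ℝ) = 0) (hU : (inner ℝ U U : ℝ) = 1) :
    X = ((inner ℝ X V : ℝ) / (1 - (inner ℝ V N : ℝ) ^ 2)) • (V - (inner ℝ V N : ℝ) • N)
      + (inner ℝ X U : ℝ) • U := by
  set c : ℝ := inner ℝ V N with hc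
  have hc0 : 0 < 1 - c ^ 2 := by linarith
  set r : ℝ := √(1 - c ^ 2) with hr
  have hr0 : 0 < r := Real.sqrt_pos.2 hc0
  have hrr : r * r = 1 - c ^ 2 := Real.mul_self_sqrt hc0.le
  set T : F := V - c • N with hT
  have hTN : (inner ℝ T N : ℝ) = 0 := by
    simp [hT, inner_sub_left, inner_smul_left, hN, hc]
  have hTT : (inner ℝ T T : ℝ) = 1 - c ^ 2 := by
    have : (inner ℝ T T : ℝ) = inner ℝ T V := by
      conv_lhs => rw [hT, inner_sub_right, inner_smul_right, ← hT, hTN]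
      ring
    rw [this, hT, inner_sub_left, inner_smul_left, real_inner_comm, real_inner_self_eq_norm_sq, hV,
      real_inner_comm]
    simp only [RCLike.conj_to_real, ← hc]
    ring
  have hUT : (inner ℝ U T : ℝ) = 0 := by
    simp [hT, inner_sub_right, inner_smul_right, hUN, hUV]
  -- `T` is the part of `V` orthogonal to `N`, of length `r`; expanding `X` in this orthonormal
  -- basis gives the formula, the `N` coefficient being zero.
  let b : Fin 3 → F := ![N, r⁻¹ • T, U]
  have hb : Orthonormal ℝ b := by
    have h1 : ‖U‖ = 1 := by
      rw [real_inner_self_eq_norm_sq] at hU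
      exact (pow_eq_one_iff_of_nonneg (norm_nonneg U) two_ne_zero).1 hU
    have h2 : ‖r⁻¹ • T‖ = 1 := by
      rw [norm_smul, norm_inv, Real.norm_of_nonneg hr0.le, norm_eq_sqrt_real_inner, hTT, ← hr,
        inv_mul_cancel₀ hr0.ne']
    have h3 : (inner ℝ (r⁻¹ • T) N : ℝ) = 0 := by rw [inner_smul_left, hTN, mul_zero]
    have h4 : (inner ℝ U (r⁻¹ • T) : ℝ) = 0 := by rw [inner_smul_right, hUT, mul_zero]
    have h3' := (real_inner_comm _ _).trans h3
    have h4' := (real_inner_comm _ _).trans h4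
    have hUN' := (real_inner_comm _ _).trans hUN
    refine ⟨fun i => ?_, fun i k hik => ?_⟩
    · fin_cases i <;> assumption
    · fin_cases i <;> fin_cases k <;> first | exact absurd rfl hik | assumption
  have : FiniteDimensional ℝ F := Module.finite_of_finrank_pos (by omega)
  have hcard : Fintype.card (Fin 3) = Module.finrank ℝ F := by simp [hF]
  let B : OrthonormalBasis (Fin 3) ℝ F := OrthonormalBasis.mk hb (by
    have := (basisOfOrthonormalOfCardEqFinrank hb hcard).span_eq
    rw [coe_basisOfOrthonormalOfCardEqFinrank] at this
    exact this.ge)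
  have hs := B.sum_repr' X
  have hBb : ∀ i, B i = b i := fun i => by simp [B]
  have hXT : (inner ℝ X T : ℝ) = inner ℝ X V := by
    simp [hT, inner_sub_right, inner_smul_right, hX]
  simp only [Fin.sum_univ_three, hBb] at hs
  simp only [b, Matrix.cons_val_zero, Matrix.cons_val_one, Matrix.cons_val] at hs
  rw [real_inner_comm, hX, zero_smul, zero_add, inner_smul_left, real_inner_comm, hXT,
    real_inner_comm X U, smul_smul] at hs
  rw [← hrr]
  conv_lhs => rw [← hs]
  congr 2
  simp only [RCLike.conj_to_real]
  field_simp

end LinearAlgebra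

/-! ### Charts that linearize the immersion -/

section AdaptedChart

variable {M : Type*} [TopologicalSpace M] [ChartedSpace (E 3) M]
  {S : Type*} [TopologicalSpace S] [ChartedSpace (E 2) S]

/-- Charts `e` of the surface and `ψ` of the ambient manifold in which the immersion `ι` is the
injective linear map `L`. -/
structure IsAdapted (ι : S → M) (e : OpenPartialHomeomorph S (E 2))
    (ψ : OpenPartialHomeomorph M (E 3)) (L : E 2 →L[ℝ] E 3) : Prop where
  mem_atlas : e ∈ IsManifold.maximalAtlas (𝓡 2) ∞ S
  mem_atlas' : ψ ∈ IsManifold.maximalAtlas (𝓡 3) ∞ M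
  injective : Function.Injective L
  mem_source : ∀ y ∈ e.target, ι (e.symm y) ∈ ψ.source
  eq_linear : ∀ y ∈ e.target, ψ (ι (e.symm y)) = L y

/-- The local normal form of an immersion is `x ↦ (x, 0)` followed by a linear equivalence onto
`ℝ³`; the composite is `L`. -/
theorem exists_isAdapted {ι : S → M} (hι : Manifold.IsImmersion (𝓡 2) (𝓡 3) ∞ ι) (p : S) :
    ∃ e ψ L, p ∈ e.source ∧ IsAdapted ι e ψ L := by
  obtain ⟨F, _, _, h⟩ := hι.isImmersionAt p
  refine ⟨h.domChart, h.codChart, h.equiv.toContinuousLinearMap ∘L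
    ContinuousLinearMap.inl ℝ (E 2) F, h.mem_domChart_source, h.domChart_mem_maximalAtlas,
    h.codChart_mem_maximalAtlas, ?_, ?_, ?_⟩
  · exact h.equiv.injective.comp (Prod.mk_left_injective 0)
  · exact fun y hy => h.source_subset_preimage_source (h.domChart.map_target hy)
  · intro y hy
    have := h.writtenInCharts (show y ∈ (h.domChart.extend (𝓡 2)).target by simpa using hy)
    simpa using this

variable {ι : S → M} {e : OpenPartialHomeomorph S (E 2)}
    {ψ : OpenPartialHomeomorph M (E 3)} {L : E 2 →L[ℝ] E 3}

theorem contMDiffAt_comp_symm (hι : ContMDiff (𝓡 2) (𝓡 3) ∞ ι)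
    (he : e ∈ IsManifold.maximalAtlas (𝓡 2) ∞ S) {x : E 2} (hx : x ∈ e.target) :
    ContMDiffAt (𝓡 2) (𝓡 3) ∞ (ι ∘ e.symm) x :=
  hι.contMDiffAt.comp x
    ((contMDiffOn_symm_of_mem_maximalAtlas he).contMDiffAt (e.open_target.mem_nhds hx))

theorem IsAdapted.mfderiv_apply (h : IsAdapted ι e ψ L) (hι : ContMDiff (𝓡 2) (𝓡 3) ∞ ι)
    {x : E 2} (hx : x ∈ e.target) (v : E 2) :
    mfderiv (𝓡 2) (𝓡 3) (ι ∘ e.symm) x v = coordField ψ (L v) (ι (e.symm x)) :=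
  mfderiv_eq_coordField h.mem_atlas'
    ((contMDiffAt_comp_symm hι h.mem_atlas hx).mdifferentiableAt (by simp))
    (h.mem_source x hx)
    (Filter.eventually_of_mem (e.open_target.mem_nhds hx) h.eq_linear) v

theorem IsAdapted.mfderiv_injective (h : IsAdapted ι e ψ L) (hι : ContMDiff (𝓡 2) (𝓡 3) ∞ ι)
    {x : E 2} (hx : x ∈ e.target) {v : E 2}
    (hv : mfderiv (𝓡 2) (𝓡 3) (ι ∘ e.symm) x v = 0) : v = 0 := by
  rw [h.mfderiv_apply hι hx] at hv
  obtain ⟨E', hE⟩ := isInvertible_mfderiv_chart h.mem_atlas' (h.mem_source x hx)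
  have h1 : E'.symm (L v) = 0 := by
    have : coordField ψ (L v) (ι (e.symm x)) = E'.symm (L v) := by
      change (mfderiv (𝓡 3) 𝓘(ℝ, E 3) ψ _).inverse (L v) = _
      rw [← hE, ContinuousLinearMap.inverse_equiv]
      rfl
    rw [← this, hv]
  have h2 : L v = 0 := by
    exact (E'.apply_symm_apply _).symm.trans ((congrArg E' h1).trans (map_zero E'))
  exact h.injective (h2.trans (map_zero L).symm)

variable [IsManifold (𝓡 3) ∞ M]

theorem contMDiffAt_along_comp_symm {W : (p : S) → TangentSpace (𝓡 3) (ι p)} {p : S}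
    (hW : ContMDiffAt (𝓡 2) (𝓡 3).tangent ∞
      (fun p => (⟨ι p, W p⟩ : TangentBundle (𝓡 3) M)) p)
    (he : e ∈ IsManifold.maximalAtlas (𝓡 2) ∞ S) {x : E 2} (hx : x ∈ e.target)
    (hp : e.symm x = p) :
    ContMDiffAt (𝓡 2) (𝓡 3).tangent ∞
      (fun y => (⟨ι (e.symm y), W (e.symm y)⟩ : TangentBundle (𝓡 3) M)) x := by
  subst hp
  exact ContMDiffAt.comp x (g := fun p => (⟨ι p, W p⟩ : TangentBundle (𝓡 3) M)) hW
    ((contMDiffOn_symm_of_mem_maximalAtlas he).contMDiffAt (e.open_target.mem_nhds hx))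

theorem IsAdapted.contMDiffAt_coordField_comp (h : IsAdapted ι e ψ L)
    (hι : ContMDiff (𝓡 2) (𝓡 3) ∞ ι) (c : E 3) {x : E 2} (hx : x ∈ e.target) :
    ContMDiffAt (𝓡 2) (𝓡 3).tangent ∞
      (fun y => (⟨ι (e.symm y), coordField ψ c (ι (e.symm y))⟩ : TangentBundle (𝓡 3) M)) x :=
  ContMDiffAt.comp x (g := fun m => (⟨m, coordField ψ c m⟩ : TangentBundle (𝓡 3) M))
    (f := ι ∘ e.symm) (contMDiffAt_coordField h.mem_atlas' c (h.mem_source x hx))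
    (contMDiffAt_comp_symm hι h.mem_atlas hx)

variable [Bundle.RiemannianBundle (fun x : M => TangentSpace (𝓡 3) x)]

/-- The one-form `v ↦ ⟨W, d(ι ∘ e⁻¹) v⟩` of a vector field `W` along `ι` in the coordinates `e`. -/
def alongForm (ι : S → M) (e : OpenPartialHomeomorph S (E 2))
    (W : (p : S) → TangentSpace (𝓡 3) (ι p)) (y : E 2) : E 2 →L[ℝ] ℝ :=
  (innerSL ℝ (W (e.symm y))) ∘L (mfderiv (𝓡 2) (𝓡 3) (ι ∘ e.symm) y)

omit [ChartedSpace (E 2) S] [IsManifold (𝓡 3) ∞ M] in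
theorem alongForm_apply (W : (p : S) → TangentSpace (𝓡 3) (ι p)) (y v : E 2) :
    alongForm ι e W y v = inner ℝ (W (e.symm y)) (mfderiv (𝓡 2) (𝓡 3) (ι ∘ e.symm) y v) := rfl

variable [IsContMDiffRiemannianBundle (𝓡 3) ∞ (E 3) (fun x : M => TangentSpace (𝓡 3) x)]

/-- A map into continuous linear maps on a finite-dimensional space is smooth if its evaluations
are. -/
theorem contDiffAt_of_apply {D G H : Type*} [NormedAddCommGroup D] [NormedSpace ℝ D]
    [NormedAddCommGroup G] [NormedSpace ℝ G] [FiniteDimensional ℝ G]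
    [NormedAddCommGroup H] [NormedSpace ℝ H] {f : D → G →L[ℝ] H} {x : D}
    (h : ∀ v, ContDiffAt ℝ ∞ (fun y => f y v) x) : ContDiffAt ℝ ∞ f x := by
  let d := Module.finrank ℝ G
  have hd : d = Module.finrank ℝ (Fin d → ℝ) := (Module.finrank_fin_fun ℝ).symm
  let e₁ := ContinuousLinearEquiv.ofFinrankEq hd
  let e₂ := (e₁.arrowCongr (1 : H ≃L[ℝ] H)).trans (ContinuousLinearEquiv.piRing (Fin d))
  rw [← Function.id_comp f, ← e₂.symm_comp_self]
  exact e₂.symm.contDiff.contDiffAt.comp x (contDiffAt_pi.mpr fun i => h _)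

/-- Evaluated on a fixed `v`, the form is the inner product of two smooth sections along the
surface, since the image of `v` is the restriction of `coordField ψ (L v)`. -/
theorem IsAdapted.contDiffAt_alongForm (h : IsAdapted ι e ψ L) (hι : ContMDiff (𝓡 2) (𝓡 3) ∞ ι)
    {W : (p : S) → TangentSpace (𝓡 3) (ι p)} {x : E 2} (hx : x ∈ e.target)
    (hW : ContMDiffAt (𝓡 2) (𝓡 3).tangent ∞
      (fun p => (⟨ι p, W p⟩ : TangentBundle (𝓡 3) M)) (e.symm x)) :
    ContDiffAt ℝ ∞ (alongForm ι e W) x := by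
  refine contDiffAt_of_apply fun v => ?_
  have h1 : ContMDiffAt (𝓡 2) 𝓘(ℝ, ℝ) ∞
      (fun y => (inner ℝ (W (e.symm y)) (coordField ψ (L v) (ι (e.symm y))) : ℝ)) x :=
    ContMDiffAt.inner_bundle (contMDiffAt_along_comp_symm hW h.mem_atlas hx rfl)
      (h.contMDiffAt_coordField_comp hι (L v) hx)
  refine h1.contDiffAt.congr_of_eventuallyEq ?_
  filter_upwards [e.open_target.mem_nhds hx] with y hy
  rw [alongForm_apply, h.mfderiv_apply hι hy]

end AdaptedChart

/-! ### Exterior derivatives of the forms dual to fields along the surface -/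

section StructureEquations

variable {M : Type*} [TopologicalSpace M] [ChartedSpace (E 3) M] [IsManifold (𝓡 3) ∞ M]
  [Bundle.RiemannianBundle (fun x : M => TangentSpace (𝓡 3) x)]
  [IsContMDiffRiemannianBundle (𝓡 3) ∞ (E 3) (fun x : M => TangentSpace (𝓡 3) x)]
  {nabla : CovariantDerivative (𝓡 3) (E 3) (fun x : M => TangentSpace (𝓡 3) x)}
  {S : Type*} [TopologicalSpace S] [ChartedSpace (E 2) S]
  {ι : S → M} {e : OpenPartialHomeomorph S (E 2)}
  {ψ : OpenPartialHomeomorph M (E 3)} {L : E 2 →L[ℝ] E 3}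

omit [ChartedSpace (E 2) S] [IsManifold (𝓡 3) ∞ M]
  [Bundle.RiemannianBundle (fun x : M => TangentSpace (𝓡 3) x)]
  [IsContMDiffRiemannianBundle (𝓡 3) ∞ (E 3) (fun x : M => TangentSpace (𝓡 3) x)] in
theorem eventually_comp_symm {P : S → Prop} {x : E 2} (hx : x ∈ e.target)
    (h : ∀ᶠ q in 𝓝 (e.symm x), P q) : ∀ᶠ y in 𝓝 x, P (e.symm y) :=
  (e.symm.continuousAt hx).eventually h

/-- The Leibniz rule for `⟨W, ∂ᵥ⟩` produces `⟨∇ᵤ W, ∂ᵥ⟩ + ⟨W, ∇ᵤ ∂ᵥ⟩`. The second term is symmetric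
in `u`, `v` by vanishing torsion, so it drops out of the exterior derivative. -/
theorem fderiv_alongForm_sub (hnabla : IsLeviCivita nabla) (h : IsAdapted ι e ψ L)
    (hι : ContMDiff (𝓡 2) (𝓡 3) ∞ ι) {x : E 2} (hx : x ∈ e.target)
    {W : (p : S) → TangentSpace (𝓡 3) (ι p)} {W' : (m : M) → TangentSpace (𝓡 3) m}
    (hW' : DiffFieldAt W' (ι (e.symm x))) (heq : ∀ᶠ q in 𝓝 (e.symm x), W' (ι q) = W q)
    (hd : DifferentiableAt ℝ (alongForm ι e W) x) (u v : E 2) :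
    fderiv ℝ (alongForm ι e W) x u v - fderiv ℝ (alongForm ι e W) x v u =
      inner ℝ (nabla W' (ι (e.symm x)) (mfderiv (𝓡 2) (𝓡 3) (ι ∘ e.symm) x u))
        (mfderiv (𝓡 2) (𝓡 3) (ι ∘ e.symm) x v)
      - inner ℝ (nabla W' (ι (e.symm x)) (mfderiv (𝓡 2) (𝓡 3) (ι ∘ e.symm) x v))
        (mfderiv (𝓡 2) (𝓡 3) (ι ∘ e.symm) x u) := by
  have hj : MDifferentiableAt (𝓡 2) (𝓡 3) (ι ∘ e.symm) x :=
    (contMDiffAt_comp_symm hι h.mem_atlas hx).mdifferentiableAt (by simp)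
  have key : ∀ u v : E 2, fderiv ℝ (alongForm ι e W) x u v =
      inner ℝ (nabla W' (ι (e.symm x)) (mfderiv (𝓡 2) (𝓡 3) (ι ∘ e.symm) x u))
        (mfderiv (𝓡 2) (𝓡 3) (ι ∘ e.symm) x v)
      + inner ℝ (W' (ι (e.symm x)))
        (nabla (coordField ψ (L v)) (ι (e.symm x)) (coordField ψ (L u) (ι (e.symm x)))) := by
    intro u v
    have h1 : fderiv ℝ (alongForm ι e W) x u v = fderiv ℝ (fun y => alongForm ι e W y v) x u := by
      rw [fderiv_clm_apply hd (differentiableAt_const v)]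
      simp
    rw [h1, h.mfderiv_apply hι hx v, ← h.mfderiv_apply hι hx u]
    refine hnabla.fderiv_inner_comp hj hW'
      ((contMDiffAt_coordField h.mem_atlas' (L v) (h.mem_source x hx)).mdifferentiableAt (by simp))
      ?_ u
    filter_upwards [e.open_target.mem_nhds hx, eventually_comp_symm hx heq] with y hy hy'
    rw [alongForm_apply, h.mfderiv_apply hι hy v]
    exact congrArg (fun w => (inner ℝ w (coordField ψ (L v) (ι (e.symm y))) : ℝ)) hy'.symm
  rw [key, key, hnabla.nabla_coordField_comm h.mem_atlas' (h.mem_source x hx)]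
  ring

omit [IsManifold (𝓡 3) ∞ M] [Bundle.RiemannianBundle (fun x : M => TangentSpace (𝓡 3) x)]
  [IsContMDiffRiemannianBundle (𝓡 3) ∞ (E 3) (fun x : M => TangentSpace (𝓡 3) x)] in
theorem mfderiv_comp_symm_apply (hι : ContMDiff (𝓡 2) (𝓡 3) ∞ ι)
    (he : e ∈ IsManifold.maximalAtlas (𝓡 2) ∞ S) {x : E 2} (hx : x ∈ e.target) (v : E 2) :
    mfderiv (𝓡 2) (𝓡 3) (ι ∘ e.symm) x v =
      mfderiv (𝓡 2) (𝓡 3) ι (e.symm x) (mfderiv (𝓡 2) (𝓡 2) e.symm x v) :=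
  mfderiv_comp_apply x (hι.mdifferentiableAt (by simp))
    (((contMDiffOn_symm_of_mem_maximalAtlas he).contMDiffAt
      (e.open_target.mem_nhds hx)).mdifferentiableAt (by simp)) v

variable {N V : (p : S) → TangentSpace (𝓡 3) (ι p)} {θ f : S → ℝ}

/-- `⟨V, N⟩ = cos θ` satisfies `d(cos θ) = - f cos θ ⟨V, ·⟩`. -/
theorem fderiv_cos_angle (hnabla : IsLeviCivita nabla)
    (hι : ContMDiff (𝓡 2) (𝓡 3) ∞ ι) (hN : IsUnitNormal ι N) (hPA : IsPrescribedAngle ι N V θ)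
    (hV : IsAntiTorquedAlong nabla ι V f) (hgeo : IsTotallyGeodesic nabla ι N)
    (he : e ∈ IsManifold.maximalAtlas (𝓡 2) ∞ S) {x : E 2} (hx : x ∈ e.target) (v : E 2) :
    fderiv ℝ (fun y => Real.cos (θ (e.symm y))) x v =
      -(f (e.symm x) * Real.cos (θ (e.symm x)) * alongForm ι e V x v) := by
  obtain ⟨V', hV', hVe, hVD⟩ := hV.covDeriv_eq (e.symm x)
  obtain ⟨N', hN', hNe, hND⟩ := hgeo (e.symm x)
  have hj : MDifferentiableAt (𝓡 2) (𝓡 3) (ι ∘ e.symm) x :=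
    (contMDiffAt_comp_symm hι he hx).mdifferentiableAt (by simp)
  rw [hnabla.fderiv_inner_comp hj (hV'.mdifferentiableAt (by simp))
    (hN'.mdifferentiableAt (by simp)) (H := fun y => Real.cos (θ (e.symm y)))]
  · rw [alongForm_apply, mfderiv_comp_symm_apply hι he hx, Function.comp_apply, hVD, hND,
      hVe.self_of_nhds, hNe.self_of_nhds]
    have h1 := hN.orthogonal (e.symm x) (mfderiv (𝓡 2) (𝓡 2) e.symm x v)
    have h2 := hPA.inner_eq (e.symm x)
    rw [real_inner_comm] at h1
    simp only [inner_smul_left, inner_sub_left, h1, h2, RCLike.conj_to_real, inner_neg_right,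
      zero_apply, map_zero, inner_zero_right,
      real_inner_comm (V (e.symm x))]
    ring
  · filter_upwards [eventually_comp_symm hx hVe, eventually_comp_symm hx hNe] with y h1 h2
    rw [← hPA.inner_eq]
    exact congrArg₂ (fun a b => (inner ℝ a b : ℝ)) h1.symm h2.symm

/-- `⟨∇_X V, Y⟩ = f (⟨X, Y⟩ - ⟨X, V⟩ ⟨Y, V⟩)` is symmetric in `X` and `Y`, so `α` is closed. -/
theorem fderiv_alongForm_field_comm (hnabla : IsLeviCivita nabla) (h : IsAdapted ι e ψ L)
    (hι : ContMDiff (𝓡 2) (𝓡 3) ∞ ι) (hPA : IsPrescribedAngle ι N V θ)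
    (hV : IsAntiTorquedAlong nabla ι V f) {x : E 2} (hx : x ∈ e.target) (u v : E 2) :
    fderiv ℝ (alongForm ι e V) x u v = fderiv ℝ (alongForm ι e V) x v u := by
  obtain ⟨V', hV', hVe, hVD⟩ := hV.covDeriv_eq (e.symm x)
  have hd : DifferentiableAt ℝ (alongForm ι e V) x :=
    (h.contDiffAt_alongForm hι hx (hPA.smooth_field _)).differentiableAt (by simp)
  have key := fderiv_alongForm_sub hnabla h hι hx (hV'.mdifferentiableAt (by simp)) hVe hd u v
  rw [← sub_eq_zero, key]
  simp only [mfderiv_comp_symm_apply hι h.mem_atlas hx]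
  rw [hVD, hVD]
  simp only [inner_smul_left, inner_sub_left, RCLike.conj_to_real, real_inner_comm (V (e.symm x))]
  linear_combination (-(f (e.symm x))) * real_inner_comm
    (mfderiv (𝓡 2) (𝓡 3) ι (e.symm x) (mfderiv (𝓡 2) (𝓡 2) e.symm x u))
    (mfderiv (𝓡 2) (𝓡 3) ι (e.symm x) (mfderiv (𝓡 2) (𝓡 2) e.symm x v))

omit [IsContMDiffRiemannianBundle (𝓡 3) ∞ (E 3) (fun x : M => TangentSpace (𝓡 3) x)] in
/-- A tangent vector in terms of the tangential part of `V` and of the unit tangent vector `U`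
orthogonal to `V`. -/
theorem mfderiv_comp_symm_eq (hι : ContMDiff (𝓡 2) (𝓡 3) ∞ ι) (hN : IsUnitNormal ι N)
    (hPA : IsPrescribedAngle ι N V θ) (he : e ∈ IsManifold.maximalAtlas (𝓡 2) ∞ S)
    {x : E 2} (hx : x ∈ e.target) (hθ : Real.sin (θ (e.symm x)) ≠ 0)
    {U : (p : S) → TangentSpace (𝓡 3) (ι p)}
    (hU : inner ℝ (U (e.symm x)) (U (e.symm x)) = 1)
    (hUN : inner ℝ (U (e.symm x)) (N (e.symm x)) = 0)
    (hUV : inner ℝ (U (e.symm x)) (V (e.symm x)) = 0) (v : E 2) :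
    mfderiv (𝓡 2) (𝓡 3) (ι ∘ e.symm) x v =
      (alongForm ι e V x v / Real.sin (θ (e.symm x)) ^ 2) •
        (V (e.symm x) - Real.cos (θ (e.symm x)) • N (e.symm x))
      + alongForm ι e U x v • U (e.symm x) := by
  have hsin : 1 - (inner ℝ (V (e.symm x)) (N (e.symm x)) : ℝ) ^ 2
      = Real.sin (θ (e.symm x)) ^ 2 := by
    rw [hPA.inner_eq, Real.sin_sq]
  have hpos : 0 < Real.sin (θ (e.symm x)) ^ 2 := by positivity
  have hYN : (inner ℝ (mfderiv (𝓡 2) (𝓡 3) (ι ∘ e.symm) x v : TangentSpace (𝓡 3) (ι (e.symm x)))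
      (N (e.symm x)) : ℝ) = 0 := by
    rw [real_inner_comm, mfderiv_comp_symm_apply hι he hx]
    exact hN.orthogonal _ _
  have key := eq_smul_add_smul_of_orthogonal (hPA.norm_eq_one (e.symm x))
    (hN.norm_eq_one (e.symm x)) (by linarith) hYN
    (by exact finrank_euclideanSpace_fin (𝕜 := ℝ) (n := 3)) hUN hUV hU
  rw [hsin, hPA.inner_eq] at key
  refine key.trans ?_
  rw [alongForm_apply, alongForm_apply, real_inner_comm, real_inner_comm (U (e.symm x))]

/-- Differentiating `⟨U, U⟩ = 1`, `⟨U, N⟩ = 0` and `⟨U, V⟩ = 0` determines the components of `∇_X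
U`: those along `U` and `N` vanish, the latter because `N` is parallel, and the one along `V` is `-f
⟨U, X⟩`. The decomposition of tangent vectors then yields `dβ`. -/
theorem fderiv_alongForm_orthogonal_sub (hnabla : IsLeviCivita nabla) (h : IsAdapted ι e ψ L)
    (hι : ContMDiff (𝓡 2) (𝓡 3) ∞ ι) (hN : IsUnitNormal ι N)
    (hPA : IsPrescribedAngle ι N V θ) (hV : IsAntiTorquedAlong nabla ι V f)
    (hgeo : IsTotallyGeodesic nabla ι N) {x : E 2} (hx : x ∈ e.target)
    (hθ : Real.sin (θ (e.symm x)) ≠ 0)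
    {U : (p : S) → TangentSpace (𝓡 3) (ι p)} {U' : (m : M) → TangentSpace (𝓡 3) m}
    (hU' : DiffFieldAt U' (ι (e.symm x))) (hUe : ∀ᶠ q in 𝓝 (e.symm x), U' (ι q) = U q)
    (hd : DifferentiableAt ℝ (alongForm ι e U) x)
    (hU : ∀ᶠ q in 𝓝 (e.symm x), inner ℝ (U q) (U q) = 1)
    (hUN : ∀ᶠ q in 𝓝 (e.symm x), inner ℝ (U q) (N q) = 0)
    (hUV : ∀ᶠ q in 𝓝 (e.symm x), inner ℝ (U q) (V q) = 0) (u v : E 2) :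
    fderiv ℝ (alongForm ι e U) x u v - fderiv ℝ (alongForm ι e U) x v u =
      f (e.symm x) / Real.sin (θ (e.symm x)) ^ 2 *
        (alongForm ι e V x u * alongForm ι e U x v - alongForm ι e V x v * alongForm ι e U x u) := by
  obtain ⟨V', hV', hVe, hVD⟩ := hV.covDeriv_eq (e.symm x)
  obtain ⟨N', hN', hNe, hND⟩ := hgeo (e.symm x)
  have hj : MDifferentiableAt (𝓡 2) (𝓡 3) (ι ∘ e.symm) x :=
    (contMDiffAt_comp_symm hι h.mem_atlas hx).mdifferentiableAt (by simp)
  have hV1 : DiffFieldAt V' ((ι ∘ e.symm) x) := hV'.mdifferentiableAt (by simp)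
  have hN1 : DiffFieldAt N' ((ι ∘ e.symm) x) := hN'.mdifferentiableAt (by simp)
  have hU1 : DiffFieldAt U' ((ι ∘ e.symm) x) := hU'
  have hUU : ∀ u : E 2, inner ℝ (nabla U' (ι (e.symm x))
      (mfderiv (𝓡 2) (𝓡 3) (ι ∘ e.symm) x u)) (U (e.symm x)) = (0 : ℝ) := by
    intro u
    have h1 := hnabla.fderiv_inner_comp hj hU1 hU1 (H := fun _ => 1) (by
      filter_upwards [eventually_comp_symm hx hU, eventually_comp_symm hx hUe] with y h1 h2
      rw [← h1]
      exact congrArg₂ (fun a b => (inner ℝ a b : ℝ)) h2.symm h2.symm) u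
    rw [fderiv_fun_const, Function.comp_apply, hUe.self_of_nhds] at h1
    have h2 := real_inner_comm (U (e.symm x)) (nabla U' (ι (e.symm x))
      (mfderiv (𝓡 2) (𝓡 3) (ι ∘ e.symm) x u))
    simp only [Pi.zero_apply, zero_apply] at h1
    linarith
  have hUN1 : ∀ u : E 2, inner ℝ (nabla U' (ι (e.symm x))
      (mfderiv (𝓡 2) (𝓡 3) (ι ∘ e.symm) x u)) (N (e.symm x)) = (0 : ℝ) := by
    intro u
    have h1 := hnabla.fderiv_inner_comp hj hU1 hN1 (H := fun _ => 0) (by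
      filter_upwards [eventually_comp_symm hx hUN, eventually_comp_symm hx hUe,
        eventually_comp_symm hx hNe] with y h1 h2 h3
      rw [← h1]
      exact congrArg₂ (fun a b => (inner ℝ a b : ℝ)) h2.symm h3.symm) u
    rw [fderiv_fun_const, Function.comp_apply, hUe.self_of_nhds, hNe.self_of_nhds,
      mfderiv_comp_symm_apply hι h.mem_atlas hx, hND] at h1
    rw [mfderiv_comp_symm_apply hι h.mem_atlas hx]
    simpa using h1.symm
  have hUV1 : ∀ u : E 2, inner ℝ (nabla U' (ι (e.symm x))
      (mfderiv (𝓡 2) (𝓡 3) (ι ∘ e.symm) x u)) (V (e.symm x))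
        = -(f (e.symm x) * alongForm ι e U x u) := by
    intro u
    have h1 := hnabla.fderiv_inner_comp hj hU1 hV1 (H := fun _ => 0) (by
      filter_upwards [eventually_comp_symm hx hUV, eventually_comp_symm hx hUe,
        eventually_comp_symm hx hVe] with y h1 h2 h3
      rw [← h1]
      exact congrArg₂ (fun a b => (inner ℝ a b : ℝ)) h2.symm h3.symm) u
    have h2 := hUV.self_of_nhds
    rw [fderiv_fun_const, Function.comp_apply, hUe.self_of_nhds, hVe.self_of_nhds,
      mfderiv_comp_symm_apply hι h.mem_atlas hx, hVD] at h1
    rw [alongForm_apply, mfderiv_comp_symm_apply hι h.mem_atlas hx]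
    simp only [Pi.zero_apply, zero_apply, inner_smul_right, inner_sub_right, h2] at h1
    linarith
  rw [fderiv_alongForm_sub hnabla h hι hx hU' hUe hd]
  have key : ∀ u v : E 2, inner ℝ (nabla U' (ι (e.symm x))
      (mfderiv (𝓡 2) (𝓡 3) (ι ∘ e.symm) x u)) (mfderiv (𝓡 2) (𝓡 3) (ι ∘ e.symm) x v)
      = -(f (e.symm x) / Real.sin (θ (e.symm x)) ^ 2 *
        (alongForm ι e V x v * alongForm ι e U x u)) := by
    intro u v
    rw [mfderiv_comp_symm_eq hι hN hPA h.mem_atlas hx hθ hU.self_of_nhds hUN.self_of_nhds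
      hUV.self_of_nhds v]
    simp only [inner_add_right, inner_smul_right, inner_sub_right]
    rw [hUU, hUV1, hUN1]
    ring
  rw [key, key]
  ring

omit [IsContMDiffRiemannianBundle (𝓡 3) ∞ (E 3) (fun x : M => TangentSpace (𝓡 3) x)] in
theorem inner_mfderiv_comp_symm (hι : ContMDiff (𝓡 2) (𝓡 3) ∞ ι) (hN : IsUnitNormal ι N)
    (hPA : IsPrescribedAngle ι N V θ) (he : e ∈ IsManifold.maximalAtlas (𝓡 2) ∞ S)
    {x : E 2} (hx : x ∈ e.target) (hθ : Real.sin (θ (e.symm x)) ≠ 0)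
    {U : (p : S) → TangentSpace (𝓡 3) (ι p)}
    (hU : inner ℝ (U (e.symm x)) (U (e.symm x)) = 1)
    (hUN : inner ℝ (U (e.symm x)) (N (e.symm x)) = 0)
    (hUV : inner ℝ (U (e.symm x)) (V (e.symm x)) = 0) (u v : E 2) :
    (inner ℝ (mfderiv (𝓡 2) (𝓡 3) (ι ∘ e.symm) x u)
      (mfderiv (𝓡 2) (𝓡 3) (ι ∘ e.symm) x v) : ℝ) =
      alongForm ι e V x u * alongForm ι e V x v / Real.sin (θ (e.symm x)) ^ 2
      + alongForm ι e U x u * alongForm ι e U x v := by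
  rw [mfderiv_comp_symm_eq hι hN hPA he hx hθ hU hUN hUV u]
  have h1 := hN.orthogonal (e.symm x) (mfderiv (𝓡 2) (𝓡 2) e.symm x v)
  rw [← mfderiv_comp_symm_apply hι he hx] at h1
  have h2 := alongForm_apply (e := e) V x v
  have h3 := alongForm_apply (e := e) U x v
  simp only [inner_add_left, inner_smul_left, inner_sub_left, RCLike.conj_to_real]
  rw [← h2, ← h3]
  have h4 : (inner ℝ (N (e.symm x)) (mfderiv (𝓡 2) (𝓡 3) (ι ∘ e.symm) x v) : ℝ) = 0 := h1
  rw [h4]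
  ring

end StructureEquations

/-! ### Inner products with the orthogonal unit vector -/

section UnitPerp

variable {F : Type*} [NormedAddCommGroup F] [InnerProductSpace ℝ F] {X V N : F}

theorem inner_perp_eq {Y : F} (hY : (inner ℝ N Y : ℝ) = 0) :
    (inner ℝ (perp X V N) Y : ℝ) =
      inner ℝ X Y - (inner ℝ V X : ℝ) / (1 - (inner ℝ V N : ℝ) ^ 2) * inner ℝ V Y := by
  simp only [perp, inner_sub_left, inner_smul_left, RCLike.conj_to_real, hY,
    real_inner_comm V X]
  ring

theorem inner_perp_self (hV : ‖V‖ = 1) (hN : ‖N‖ = 1) (hVN : (inner ℝ V N : ℝ) ^ 2 < 1)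
    (hX : (inner ℝ X N : ℝ) = 0) :
    (inner ℝ (perp X V N) (perp X V N) : ℝ) =
      inner ℝ X X - (inner ℝ V X : ℝ) / (1 - (inner ℝ V N : ℝ) ^ 2) * inner ℝ V X := by
  have h1 := inner_perp_normal (V := V) hN hX
  have h2 := inner_perp_field (X := X) hV hVN
  rw [← inner_perp_eq (V := V) ((real_inner_comm _ _).trans hX)]
  conv_lhs => rw [perp, inner_sub_right, inner_smul_right, inner_sub_right, inner_smul_right]
  rw [← perp, h1, h2]
  ring

/-- With `Y` tangent, the right side involves only pairings with `X` and `V`; smoothness of `β` is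
read off from it. -/
theorem inner_unitPerp_eq (hV : ‖V‖ = 1) (hN : ‖N‖ = 1) (hVN : (inner ℝ V N : ℝ) ^ 2 < 1)
    (hX : (inner ℝ X N : ℝ) = 0) {Y : F} (hY : (inner ℝ N Y : ℝ) = 0) :
    (inner ℝ (unitPerp X V N) Y : ℝ) =
      (√(inner ℝ X X - (inner ℝ V X : ℝ) / (1 - (inner ℝ V N : ℝ) ^ 2) * inner ℝ V X))⁻¹ *
      (inner ℝ X Y - (inner ℝ V X : ℝ) / (1 - (inner ℝ V N : ℝ) ^ 2) * inner ℝ V Y) := by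
  rw [unitPerp, inner_smul_left, inner_perp_self hV hN hVN hX, inner_perp_eq hY]
  rfl

end UnitPerp

/-! ### Differentiability of the orthogonal unit field -/

section UnitPerpField

variable {M : Type*} [TopologicalSpace M] [ChartedSpace (E 3) M] [IsManifold (𝓡 3) ∞ M]
  [Bundle.RiemannianBundle (fun x : M => TangentSpace (𝓡 3) x)]
  [IsContMDiffRiemannianBundle (𝓡 3) ∞ (E 3) (fun x : M => TangentSpace (𝓡 3) x)]

/-- Applied to ambient extensions of `V` and `N`, this supplies the differentiable extension of `U`
needed to form `∇U`. The two nondegeneracy conditions keep the quotient and the inverse square root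
differentiable. -/
theorem DiffFieldAt.unitPerp {X V N : (m : M) → TangentSpace (𝓡 3) m} {m : M}
    (hX : DiffFieldAt X m) (hV : DiffFieldAt V m) (hN : DiffFieldAt N m)
    (hVN : (inner ℝ (V m) (N m) : ℝ) ^ 2 < 1) (h0 : perp (X m) (V m) (N m) ≠ 0) :
    DiffFieldAt (fun m => unitPerp (X m) (V m) (N m)) m := by
  have hR : IsContMDiffRiemannianBundle (𝓡 3) 1 (E 3) (fun x : M => TangentSpace (𝓡 3) x) :=
    isContMDiffRiemannianBundle_one
  have hXV : MDifferentiableAt (𝓡 3) 𝓘(ℝ, ℝ) (fun m => (inner ℝ (X m) (V m) : ℝ)) m :=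
    MDifferentiableAt.inner_bundle hX hV
  have hVN' : MDifferentiableAt (𝓡 3) 𝓘(ℝ, ℝ) (fun m => (inner ℝ (V m) (N m) : ℝ)) m :=
    MDifferentiableAt.inner_bundle hV hN
  have hden : MDifferentiableAt (𝓡 3) 𝓘(ℝ, ℝ) (fun m => 1 - (inner ℝ (V m) (N m) : ℝ) ^ 2) m :=
    mdifferentiableAt_const.sub (hVN'.pow 2)
  have hq : MDifferentiableAt (𝓡 3) 𝓘(ℝ, ℝ)
      (fun m => (inner ℝ (X m) (V m) : ℝ) / (1 - (inner ℝ (V m) (N m) : ℝ) ^ 2)) m :=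
    hXV.div hden (by linarith)
  have hperp : DiffFieldAt (fun m => perp (X m) (V m) (N m)) m :=
    mdifferentiableAt_sub_section hX (MDifferentiableAt.smul_section hq
      (mdifferentiableAt_sub_section hV (MDifferentiableAt.smul_section hVN' hN)))
  have hpp : MDifferentiableAt (𝓡 3) 𝓘(ℝ, ℝ)
      (fun m => (inner ℝ (perp (X m) (V m) (N m)) (perp (X m) (V m) (N m)) : ℝ)) m :=
    MDifferentiableAt.inner_bundle hperp hperp
  have hpos : 0 < (inner ℝ (perp (X m) (V m) (N m)) (perp (X m) (V m) (N m)) : ℝ) :=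
    real_inner_self_pos.2 h0
  have hs : MDifferentiableAt (𝓡 3) 𝓘(ℝ, ℝ)
      (fun m => (√(inner ℝ (perp (X m) (V m) (N m)) (perp (X m) (V m) (N m)) : ℝ))⁻¹) m :=
    MDifferentiableAt.comp (I' := 𝓘(ℝ, ℝ)) (g := fun t : ℝ => (√t)⁻¹) m
      (((differentiableAt_id.sqrt hpos.ne').inv (Real.sqrt_pos.2 hpos).ne').mdifferentiableAt) hpp
  exact MDifferentiableAt.smul_section hs hperp

end UnitPerpField

/-! ### The local coframe and its structure equations -/

section LocalCoframe

variable {M : Type*} [TopologicalSpace M] [ChartedSpace (E 3) M] [IsManifold (𝓡 3) ∞ M]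
  [Bundle.RiemannianBundle (fun x : M => TangentSpace (𝓡 3) x)]
  [IsContMDiffRiemannianBundle (𝓡 3) ∞ (E 3) (fun x : M => TangentSpace (𝓡 3) x)]
  {nabla : CovariantDerivative (𝓡 3) (E 3) (fun x : M => TangentSpace (𝓡 3) x)}
  {S : Type*} [TopologicalSpace S] [ChartedSpace (E 2) S]
  {ι : S → M} {e : OpenPartialHomeomorph S (E 2)}
  {ψ : OpenPartialHomeomorph M (E 3)} {L : E 2 →L[ℝ] E 3}
  {N V : (p : S) → TangentSpace (𝓡 3) (ι p)} {θ f : S → ℝ}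

omit [ChartedSpace (E 3) M] in
theorem contDiffAt_comp_symm {g : S → ℝ} (hg : ContMDiff (𝓡 2) 𝓘(ℝ, ℝ) ∞ g)
    (he : e ∈ IsManifold.maximalAtlas (𝓡 2) ∞ S) {x : E 2} (hx : x ∈ e.target) :
    ContDiffAt ℝ ∞ (fun y => g (e.symm y)) x :=
  (hg.contMDiffAt.comp x ((contMDiffOn_symm_of_mem_maximalAtlas he).contMDiffAt
    (e.open_target.mem_nhds hx))).contDiffAt

/-- In the coordinates `e` the one-forms `α = ⟨V, ·⟩` and `β = ⟨U, ·⟩`, where `U` is the unit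
tangent field orthogonal to `V`, satisfy the structure equations of the surface at `x`. -/
structure StructureEquationsAt (ι : S → M) (θ f : S → ℝ) (e : OpenPartialHomeomorph S (E 2))
    (α β : E 2 → E 2 →L[ℝ] ℝ) (x : E 2) : Prop where
  sin_pos : 0 < Real.sin (θ (e.symm x))
  smooth_left : ContDiffAt ℝ ∞ α x
  smooth_right : ContDiffAt ℝ ∞ β x
  fderiv_cos : ∀ v, fderiv ℝ (fun y => Real.cos (θ (e.symm y))) x v =
      -(f (e.symm x) * Real.cos (θ (e.symm x)) * α x v)
  fderiv_left : ∀ u v, fderiv ℝ α x u v = fderiv ℝ α x v u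
  fderiv_right : ∀ u v, fderiv ℝ β x u v - fderiv ℝ β x v u =
      f (e.symm x) / Real.sin (θ (e.symm x)) ^ 2 * (α x u * β x v - α x v * β x u)
  metric : ∀ u v, (inner ℝ (mfderiv (𝓡 2) (𝓡 3) (ι ∘ e.symm) x u)
      (mfderiv (𝓡 2) (𝓡 3) (ι ∘ e.symm) x v) : ℝ) =
      α x u * α x v / Real.sin (θ (e.symm x)) ^ 2 + β x u * β x v
  nondegenerate : ∀ v, α x v = 0 → β x v = 0 → v = 0

-- On a plane the linear form `α` has a nonzero kernel vector; its image is orthogonal to `V`, so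
-- `perp` leaves it unchanged, and it is nonzero because `ι` is an immersion.
omit [IsManifold (𝓡 3) ∞ M]
  [IsContMDiffRiemannianBundle (𝓡 3) ∞ (E 3) (fun x : M => TangentSpace (𝓡 3) x)] in
theorem IsAdapted.exists_perp_ne_zero (h : IsAdapted ι e ψ L) (hι : ContMDiff (𝓡 2) (𝓡 3) ∞ ι)
    {x : E 2} (hx : x ∈ e.target) : ∃ v : E 2,
      perp (coordField ψ (L v) (ι (e.symm x))) (V (e.symm x)) (N (e.symm x)) ≠ 0 := by
  obtain ⟨v, hv0, hv⟩ : ∃ v : E 2, v ≠ 0 ∧ alongForm ι e V x v = 0 := by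
    by_contra! hc
    have hinj : Function.Injective (alongForm ι e V x).toLinearMap := by
      rw [← LinearMap.ker_eq_bot, LinearMap.ker_eq_bot']
      intro v hv
      by_contra h0
      exact hc v h0 hv
    have := LinearMap.finrank_le_finrank_of_injective hinj
    simp at this
  refine ⟨v, fun h0 => hv0 (h.mfderiv_injective hι hx ?_)⟩
  rw [alongForm_apply, h.mfderiv_apply hι hx, real_inner_comm] at hv
  rw [perp, hv, zero_div, zero_smul, sub_zero] at h0
  rw [h.mfderiv_apply hι hx, h0]

/-- Normalizing the projection of one coordinate field `X` produces `U` near the point, without any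
orientation. -/
theorem eventually_structureEquationsAt (hnabla : IsLeviCivita nabla) (h : IsAdapted ι e ψ L)
    (hι : ContMDiff (𝓡 2) (𝓡 3) ∞ ι) (hN : IsUnitNormal ι N)
    (hPA : IsPrescribedAngle ι N V θ) (hV : IsAntiTorquedAlong nabla ι V f)
    (hgeo : IsTotallyGeodesic nabla ι N) {x₀ : E 2} (hx₀ : x₀ ∈ e.target)
    (hθ : 0 < Real.sin (θ (e.symm x₀))) :
    ∃ α β : E 2 → E 2 →L[ℝ] ℝ, ∀ᶠ x in 𝓝 x₀, StructureEquationsAt ι θ f e α β x := by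
  obtain ⟨v₀, hv₀⟩ := h.exists_perp_ne_zero (V := V) (N := N) hι hx₀
  let X : (p : S) → TangentSpace (𝓡 3) (ι p) := fun p => coordField ψ (L v₀) (ι p)
  let U : (p : S) → TangentSpace (𝓡 3) (ι p) := fun p => unitPerp (X p) (V p) (N p)
  -- This is the squared length of `perp X V N`, written through one-forms already known to be
  -- smooth.
  let hfun : E 2 → ℝ := fun x => alongForm ι e X x v₀ -
    alongForm ι e V x v₀ / Real.sin (θ (e.symm x)) ^ 2 * alongForm ι e V x v₀
  let Ω : Set (E 2) := {x | x ∈ e.target ∧ 0 < Real.sin (θ (e.symm x)) ∧ 0 < hfun x}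
  have hXs : ∀ x ∈ e.target, ContMDiffAt (𝓡 2) (𝓡 3).tangent ∞
      (fun p => (⟨ι p, X p⟩ : TangentBundle (𝓡 3) M)) (e.symm x) := fun x hx =>
    ContMDiffAt.comp _ (g := fun m => (⟨m, coordField ψ (L v₀) m⟩ : TangentBundle (𝓡 3) M))
      (contMDiffAt_coordField h.mem_atlas' (L v₀) (h.mem_source x hx)) hι.contMDiffAt
  have hαs : ∀ x ∈ e.target, ContDiffAt ℝ ∞ (alongForm ι e V) x := fun x hx =>
    h.contDiffAt_alongForm hι hx (hPA.smooth_field _)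
  have hξs : ∀ x ∈ e.target, ContDiffAt ℝ ∞ (alongForm ι e X) x := fun x hx =>
    h.contDiffAt_alongForm hι hx (hXs x hx)
  have hsin : ∀ x ∈ e.target, ContDiffAt ℝ ∞ (fun x => Real.sin (θ (e.symm x))) x :=
    fun x hx => (contDiffAt_comp_symm hPA.smooth_angle h.mem_atlas hx).sin
  have hqs : ∀ x ∈ e.target, 0 < Real.sin (θ (e.symm x)) → ContDiffAt ℝ ∞
      (fun x => alongForm ι e V x v₀ / Real.sin (θ (e.symm x)) ^ 2) x := fun x hx hs =>
    ((hαs x hx).clm_apply contDiffAt_const).div ((hsin x hx).pow 2) (by positivity)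
  have hhs : ∀ x ∈ e.target, 0 < Real.sin (θ (e.symm x)) → ContDiffAt ℝ ∞ hfun x :=
    fun x hx hs => ((hξs x hx).clm_apply contDiffAt_const).sub
      ((hqs x hx hs).mul ((hαs x hx).clm_apply contDiffAt_const))
  have hsq : ∀ x, 1 - (inner ℝ (V (e.symm x)) (N (e.symm x)) : ℝ) ^ 2
      = Real.sin (θ (e.symm x)) ^ 2 := fun x => by rw [hPA.inner_eq, Real.sin_sq]
  have hVN : ∀ x, 0 < Real.sin (θ (e.symm x)) →
      (inner ℝ (V (e.symm x)) (N (e.symm x)) : ℝ) ^ 2 < 1 := by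
    intro x hx
    have := hsq x
    have : 0 < Real.sin (θ (e.symm x)) ^ 2 := by positivity
    linarith
  have hNd : ∀ x ∈ e.target, ∀ v : E 2,
      (inner ℝ (N (e.symm x)) (mfderiv (𝓡 2) (𝓡 3) (ι ∘ e.symm) x v) : ℝ) = 0 := by
    intro x hx v
    rw [mfderiv_comp_symm_apply hι h.mem_atlas hx]
    exact hN.orthogonal _ _
  have hXd : ∀ x ∈ e.target, X (e.symm x) = mfderiv (𝓡 2) (𝓡 3) (ι ∘ e.symm) x v₀ :=
    fun x hx => (h.mfderiv_apply hι hx v₀).symm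
  have hXN : ∀ x ∈ e.target, (inner ℝ (X (e.symm x)) (N (e.symm x)) : ℝ) = 0 := by
    intro x hx
    rw [real_inner_comm, hXd x hx]
    exact hNd x hx v₀
  have hpp : ∀ x ∈ e.target, 0 < Real.sin (θ (e.symm x)) →
      (inner ℝ (perp (X (e.symm x)) (V (e.symm x)) (N (e.symm x)))
        (perp (X (e.symm x)) (V (e.symm x)) (N (e.symm x))) : ℝ) = hfun x := by
    intro x hx hs
    rw [inner_perp_self (hPA.norm_eq_one _) (hN.norm_eq_one _) (hVN x hs) (hXN x hx), hsq]
    simp only [hfun, alongForm_apply]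
    rw [← hXd x hx]
  have hΩ : IsOpen Ω := by
    rw [isOpen_iff_eventually]
    intro x hx
    filter_upwards [e.open_target.mem_nhds hx.1,
      (hsin x hx.1).continuousAt.eventually (lt_mem_nhds hx.2.1),
      (hhs x hx.1 hx.2.1).continuousAt.eventually (lt_mem_nhds hx.2.2)] with y h1 h2 h3
    exact ⟨h1, h2, h3⟩
  refine ⟨alongForm ι e V, alongForm ι e U, ?_⟩
  have hx₀Ω : x₀ ∈ Ω := ⟨hx₀, hθ, by
    rw [← hpp x₀ hx₀ hθ]; exact real_inner_self_pos.2 hv₀⟩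
  filter_upwards [hΩ.mem_nhds hx₀Ω] with x hx
  have hxt := hx.1
  have hsm : ContDiffAt ℝ ∞ (alongForm ι e U) x := by
    refine ContDiffAt.congr_of_eventuallyEq (f := fun y => (√(hfun y))⁻¹ • (alongForm ι e X y -
      (alongForm ι e V y v₀ / Real.sin (θ (e.symm y)) ^ 2) • alongForm ι e V y)) ?_ ?_
    · exact ((((hhs x hxt hx.2.1).sqrt hx.2.2.ne').inv (Real.sqrt_pos.2 hx.2.2).ne').smul
        ((hξs x hxt).sub ((hqs x hxt hx.2.1).smul (hαs x hxt))))
    · filter_upwards [hΩ.mem_nhds hx] with y hy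
      ext v
      have key := inner_unitPerp_eq (hPA.norm_eq_one _) (hN.norm_eq_one _) (hVN y hy.2.1)
        (hXN y hy.1) (hNd y hy.1 v)
      rw [hsq, hXd y hy.1] at key
      rw [alongForm_apply]
      refine Eq.trans ?_ (key.trans ?_)
      · rw [← hXd y hy.1]
      · simp only [hfun, alongForm_apply, smul_apply, sub_apply, smul_eq_mul]
        rw [hXd y hy.1]
  -- The relations for `U` are going to be differentiated, so they are needed on a neighbourhood in
  -- `S` and not just at one point.
  have hnear : ∀ᶠ q in 𝓝 (e.symm x), q ∈ e.source ∧ e q ∈ Ω := by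
    have hs := e.map_target hxt
    refine (e.open_source.eventually_mem hs).and
      ((e.continuousAt hs).eventually (hΩ.eventually_mem ?_))
    rwa [e.right_inv hxt]
  obtain ⟨V', hV', hVe, -⟩ := hV.covDeriv_eq (e.symm x)
  obtain ⟨N', hN', hNe, -⟩ := hgeo (e.symm x)
  have hU1 : ∀ᶠ q in 𝓝 (e.symm x), inner ℝ (U q) (U q) = (1 : ℝ) := by
    filter_upwards [hnear] with q hq
    rw [← e.left_inv hq.1]
    exact inner_unitPerp_self (real_inner_self_pos.1
      ((hq.2.2.2).trans_eq (hpp _ hq.2.1 hq.2.2.1).symm))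
  have hU2 : ∀ᶠ q in 𝓝 (e.symm x), inner ℝ (U q) (N q) = (0 : ℝ) := by
    filter_upwards [hnear] with q hq
    rw [← e.left_inv hq.1]
    exact inner_unitPerp_normal (hN.norm_eq_one _) (hXN _ hq.2.1)
  have hU3 : ∀ᶠ q in 𝓝 (e.symm x), inner ℝ (U q) (V q) = (0 : ℝ) := by
    filter_upwards [hnear] with q hq
    rw [← e.left_inv hq.1]
    exact inner_unitPerp_field (hPA.norm_eq_one _) (hVN _ hq.2.2.1)
  have hmet := inner_mfderiv_comp_symm hι hN hPA h.mem_atlas hxt hx.2.1.ne'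
      hU1.self_of_nhds hU2.self_of_nhds hU3.self_of_nhds
  refine ⟨hx.2.1, h.contDiffAt_alongForm hι hxt (hPA.smooth_field _), hsm,
    fderiv_cos_angle hnabla hι hN hPA hV hgeo h.mem_atlas hxt,
    fderiv_alongForm_field_comm hnabla h hι hPA hV hxt,
    fderiv_alongForm_orthogonal_sub hnabla h hι hN hPA hV hgeo hxt hx.2.1.ne'
      (U' := fun m => unitPerp (coordField ψ (L v₀) m) (V' m) (N' m)) ?_ ?_
      (hsm.differentiableAt (by simp)) hU1 hU2 hU3, hmet, ?_⟩
  · refine DiffFieldAt.unitPerp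
      ((contMDiffAt_coordField h.mem_atlas' _ (h.mem_source x hxt)).mdifferentiableAt (by simp))
      (hV'.mdifferentiableAt (by simp)) (hN'.mdifferentiableAt (by simp)) ?_ ?_
    · rw [hVe.self_of_nhds, hNe.self_of_nhds]
      exact hVN x hx.2.1
    · rw [hVe.self_of_nhds, hNe.self_of_nhds]
      exact real_inner_self_pos.1 (hx.2.2.trans_eq (hpp x hxt hx.2.1).symm)
  · filter_upwards [hVe, hNe] with q h1 h2
    simp only [h1, h2, U, X]
  -- By the metric formula a common zero of `α` and `β` has an image of length zero.
  · intro v h1 h2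
    refine h.mfderiv_injective hι hxt (inner_self_eq_zero (𝕜 := ℝ).1 ?_)
    rw [hmet, h1, h2]
    ring

end LocalCoframe

/-! ### Positivity of the cosine of the angle -/

section NonvanishingCosine

/-- A function on a ball whose derivative is controlled by its value vanishes if it vanishes at
the center. -/
theorem eq_zero_of_norm_fderiv_le {D : Type*} [NormedAddCommGroup D] [NormedSpace ℝ D]
    {h : D → ℝ} {x₀ : D} {r K : ℝ} (hd : ∀ x ∈ Metric.ball x₀ r, DifferentiableAt ℝ h x)
    (hK : ∀ x ∈ Metric.ball x₀ r, ‖fderiv ℝ h x‖ ≤ K * |h x|) (h0 : h x₀ = 0) :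
    ∀ x ∈ Metric.ball x₀ r, h x = 0 := by
  intro x hx
  have hr : 0 < r := Metric.pos_of_mem_ball hx
  let c : ℝ → D := fun t => x₀ + t • (x - x₀)
  have hc : ∀ t ∈ Set.Icc (0 : ℝ) 1, c t ∈ Metric.ball x₀ r := by
    intro t ht
    have := (convex_ball x₀ r).add_smul_sub_mem (Metric.mem_ball_self hr) hx ht
    exact this
  have hcd : ∀ t, HasDerivAt c (x - x₀) t := by
    intro t
    have := ((hasDerivAt_id t).smul_const (x - x₀)).const_add x₀
    rw [one_smul] at this
    exact this
  have hhd : ∀ t ∈ Set.Icc (0 : ℝ) 1, HasDerivAt (h ∘ c) (fderiv ℝ h (c t) (x - x₀)) t :=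
    fun t ht => (hd _ (hc t ht)).hasFDerivAt.comp_hasDerivAt t (hcd t)
  -- Grönwall's inequality along the segment from the center to `x`.
  have key := eq_zero_of_abs_deriv_le_mul_abs_self_of_eq_zero_right (f := h ∘ c)
    (f' := fun t => fderiv ℝ h (c t) (x - x₀)) (K := K * ‖x - x₀‖) (a := 0) (b := 1)
    (fun t ht => (hhd t ht).continuousAt.continuousWithinAt)
    (fun t ht => (hhd t (Set.Ico_subset_Icc_self ht)).hasDerivWithinAt)
    (by simp [c, h0])
    (fun t ht => by
      refine ((fderiv ℝ h (c t)).le_opNorm _).trans ?_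
      have := mul_le_mul_of_nonneg_right (hK _ (hc t (Set.Ico_subset_Icc_self ht)))
        (norm_nonneg (x - x₀))
      rw [Function.comp_apply, Real.norm_eq_abs]
      linarith) 1 (by simp)
  simpa [c] using key

variable {M : Type*} [TopologicalSpace M] [ChartedSpace (E 3) M] [IsManifold (𝓡 3) ∞ M]
  [Bundle.RiemannianBundle (fun x : M => TangentSpace (𝓡 3) x)]
  [IsContMDiffRiemannianBundle (𝓡 3) ∞ (E 3) (fun x : M => TangentSpace (𝓡 3) x)]
  {nabla : CovariantDerivative (𝓡 3) (E 3) (fun x : M => TangentSpace (𝓡 3) x)}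
  {S : Type*} [TopologicalSpace S] [ChartedSpace (E 2) S]
  {ι : S → M} {N V : (p : S) → TangentSpace (𝓡 3) (ι p)} {θ f : S → ℝ}

/-- The logarithmic-type equation `d(cos θ) = -cos θ · (f α)` has a locally bounded coefficient, so
a zero of `cos θ` spreads to a ball. -/
theorem eventually_cos_eq_zero (hnabla : IsLeviCivita nabla)
    (hι : Manifold.IsImmersion (𝓡 2) (𝓡 3) ∞ ι) (hN : IsUnitNormal ι N)
    (hPA : IsPrescribedAngle ι N V θ) (hV : IsAntiTorquedAlong nabla ι V f)
    (hgeo : IsTotallyGeodesic nabla ι N) {p : S} (hp : Real.cos (θ p) = 0) :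
    ∀ᶠ q in 𝓝 p, Real.cos (θ q) = 0 := by
  obtain ⟨e, ψ, L, hpe, h⟩ := exists_isAdapted hι p
  have hx₀ := e.map_source hpe
  let k : E 2 → ℝ := fun x => ‖f (e.symm x) • alongForm ι e V x‖
  have hk : ContinuousAt k (e p) :=
    ((contDiffAt_comp_symm hV.smooth_potential h.mem_atlas hx₀).continuousAt.smul
      (h.contDiffAt_alongForm hι.contMDiff hx₀ (hPA.smooth_field _)).continuousAt).norm
  obtain ⟨r, hr, hball⟩ := Metric.eventually_nhds_iff_ball.1
    ((hk.eventually (gt_mem_nhds (lt_add_one (k (e p))))).and (e.open_target.mem_nhds hx₀))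
  have hz := eq_zero_of_norm_fderiv_le (h := fun y => Real.cos (θ (e.symm y)))
    (x₀ := e p) (r := r) (K := k (e p) + 1)
    (fun x hx => ((contDiffAt_comp_symm hPA.smooth_angle h.mem_atlas
      (hball x hx).2).differentiableAt (by simp)).cos)
    (fun x hx => by
      have h1 : fderiv ℝ (fun y => Real.cos (θ (e.symm y))) x =
          (-Real.cos (θ (e.symm x))) • (f (e.symm x) • alongForm ι e V x) := by
        ext v
        rw [fderiv_cos_angle hnabla hι.contMDiff hN hPA hV hgeo h.mem_atlas (hball x hx).2]
        simp only [smul_apply, smul_eq_mul]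
        ring
      rw [h1, norm_smul, norm_neg, Real.norm_eq_abs, mul_comm]
      exact mul_le_mul_of_nonneg_right (hball x hx).1.le (abs_nonneg _))
    (by simpa [e.left_inv hpe] using hp)
  filter_upwards [e.open_source.mem_nhds hpe,
    (e.continuousAt hpe).eventually (Metric.ball_mem_nhds _ hr)] with q hq hq'
  simpa [e.left_inv hq] using hz _ hq'

/-- The zero set of `cos θ` is clopen. Were it everything, the range of `θ` would force `θ = π / 2`
throughout, against nonconstancy. -/
theorem cos_angle_pos [ConnectedSpace S] (hnabla : IsLeviCivita nabla)
    (hι : Manifold.IsImmersion (𝓡 2) (𝓡 3) ∞ ι) (hN : IsUnitNormal ι N)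
    (hPA : IsPrescribedAngle ι N V θ) (hV : IsAntiTorquedAlong nabla ι V f)
    (hgeo : IsTotallyGeodesic nabla ι N) (hθ : ¬ ∃ c : ℝ, ∀ p, θ p = c) (p : S) :
    0 < Real.cos (θ p) := by
  have hmem := hPA.angle_mem
  have hclopen : IsClopen {q : S | Real.cos (θ q) = 0} :=
    ⟨isClosed_eq (Real.continuous_cos.comp hPA.smooth_angle.continuous) continuous_const,
      isOpen_iff_eventually.2 fun q hq => eventually_cos_eq_zero hnabla hι hN hPA hV hgeo hq⟩
  have hnn : 0 ≤ Real.cos (θ p) := Real.cos_nonneg_of_mem_Icc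
    ⟨by linarith [(hmem p).1, Real.pi_pos], (hmem p).2⟩
  refine lt_of_le_of_ne hnn fun h0 => hθ ⟨Real.pi / 2, fun q => ?_⟩
  have hq : Real.cos (θ q) = 0 := by
    rcases isClopen_iff.1 hclopen with h | h
    · exact absurd h0.symm (Set.eq_empty_iff_forall_notMem.1 h p)
    · exact Set.eq_univ_iff_forall.1 h q
  refine le_antisymm (hmem q).2 (not_lt.1 fun hlt => ?_)
  exact (Real.cos_pos_of_mem_Ioo ⟨by linarith [(hmem q).1, Real.pi_pos], hlt⟩).ne' hq

end NonvanishingCosine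

/-! ### Coordinates from a closed coframe -/

section Rectify

/-- The open square with center `c` and side `2 δ`. -/
def square (c : E 2) (δ : ℝ) : Set (E 2) := {z | ∀ i, z i ∈ Set.Ioo (c i - δ) (c i + δ)}

theorem isOpen_square (c : E 2) (δ : ℝ) : IsOpen (square c δ) := by
  simp only [square, Set.ofPred_forall]
  exact isOpen_iInter_of_finite fun i =>
    isOpen_Ioo.preimage (EuclideanSpace.proj (𝕜 := ℝ) i).continuous

theorem mem_square_self (c : E 2) {δ : ℝ} (hδ : 0 < δ) : c ∈ square c δ :=
  fun i => ⟨by linarith, by linarith⟩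

/-- Balls of the sup norm are squares. A square target makes the range of `u` an interval and the
lines `u = const` connected. -/
theorem exists_square_subset {s : Set (E 2)} {c : E 2} (hs : s ∈ 𝓝 c) :
    ∃ δ > 0, square c δ ⊆ s := by
  have h : (WithLp.toLp 2 : (Fin 2 → ℝ) → E 2) ⁻¹' s ∈ 𝓝 (WithLp.ofLp c) :=
    (PiLp.continuous_toLp 2 (fun _ : Fin 2 => ℝ)).continuousAt.preimage_mem_nhds (by simpa using hs)
  obtain ⟨δ, hδ, hb⟩ := Metric.mem_nhds_iff.1 h
  refine ⟨δ, hδ, fun z hz => ?_⟩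
  have : WithLp.ofLp z ∈ Metric.ball (WithLp.ofLp c) δ := by
    rw [Metric.mem_ball, dist_pi_lt_iff hδ]
    intro i
    rw [Real.dist_eq, abs_lt]
    exact ⟨by linarith [(hz i).1], by linarith [(hz i).2]⟩
  simpa using hb this

/-- A closed smooth one-form on a ball has a smooth primitive. -/
theorem exists_contDiffOn_primitive {a : E 2 → E 2 →L[ℝ] ℝ} {x₀ : E 2} {r : ℝ}
    (ha : ∀ x ∈ Metric.ball x₀ r, ContDiffAt ℝ ∞ a x)
    (hc : ∀ x ∈ Metric.ball x₀ r, ∀ u v, fderiv ℝ a x u v = fderiv ℝ a x v u) :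
    ∃ s : E 2 → ℝ, ContDiffOn ℝ ∞ s (Metric.ball x₀ r) ∧
      ∀ x ∈ Metric.ball x₀ r, HasFDerivAt s (a x) x := by
  obtain ⟨s, hs⟩ := (convex_ball x₀ r).exists_forall_hasFDerivAt_of_fderiv_symmetric
    Metric.isOpen_ball (fun x hx => ((ha x hx).differentiableAt
      (by simp)).differentiableWithinAt) hc
  refine ⟨s, (contDiffOn_infty_iff_fderiv_of_isOpen Metric.isOpen_ball).2
    ⟨fun x hx => (hs x hx).differentiableAt.differentiableWithinAt, ?_⟩, hs⟩
  exact ContDiffOn.congr (fun x hx => (ha x hx).contDiffWithinAt) fun x hx => (hs x hx).fderiv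

/-- Two closed one-forms that are independent at each point are the differentials of the
coordinates of a chart onto a square. -/
theorem exists_chart_of_closed_coframe {a b : E 2 → E 2 →L[ℝ] ℝ} {x₀ : E 2} {r : ℝ} (hr : 0 < r)
    (ha : ∀ x ∈ Metric.ball x₀ r, ContDiffAt ℝ ∞ a x)
    (hb : ∀ x ∈ Metric.ball x₀ r, ContDiffAt ℝ ∞ b x)
    (hac : ∀ x ∈ Metric.ball x₀ r, ∀ u v, fderiv ℝ a x u v = fderiv ℝ a x v u)
    (hbc : ∀ x ∈ Metric.ball x₀ r, ∀ u v, fderiv ℝ b x u v = fderiv ℝ b x v u)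
    (hab : ∀ x ∈ Metric.ball x₀ r, ∀ v, a x v = 0 → b x v = 0 → v = 0) :
    ∃ (Ψ : OpenPartialHomeomorph (E 2) (E 2)) (c : E 2) (δ : ℝ), 0 < δ ∧
      Ψ ∈ contDiffGroupoid ∞ (𝓡 2) ∧ x₀ ∈ Ψ.source ∧ Ψ.source ⊆ Metric.ball x₀ r ∧
      Ψ.target = square c δ ∧ ContDiffOn ℝ ∞ Ψ.symm Ψ.target ∧
      ∀ z ∈ Ψ.target, ∀ v, a (Ψ.symm z) (fderiv ℝ Ψ.symm z v) = v 0 ∧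
        b (Ψ.symm z) (fderiv ℝ Ψ.symm z v) = v 1 := by
  obtain ⟨s, hs, hsa⟩ := exists_contDiffOn_primitive ha hac
  obtain ⟨t, ht, htb⟩ := exists_contDiffOn_primitive hb hbc
  let Φ : E 2 → E 2 := fun x => WithLp.toLp 2 ![s x, t x]
  let A : E 2 → E 2 →L[ℝ] E 2 := fun x =>
    (EuclideanSpace.equiv (Fin 2) ℝ).symm.toContinuousLinearMap ∘L
      ContinuousLinearMap.pi ![a x, b x]
  have hA0 : ∀ x v, A x v 0 = a x v := fun x v => rfl
  have hA1 : ∀ x v, A x v 1 = b x v := fun x v => rfl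
  have hΦ : ContDiffOn ℝ ∞ Φ (Metric.ball x₀ r) := by
    rw [contDiffOn_euclidean]
    intro i
    fin_cases i
    · exact hs
    · exact ht
  have hΦd : ∀ x ∈ Metric.ball x₀ r, HasFDerivAt Φ (A x) x := by
    intro x hx
    rw [← hasFDerivWithinAt_univ, hasFDerivWithinAt_euclidean]
    intro i
    fin_cases i
    · exact (hsa x hx).hasFDerivWithinAt
    · exact (htb x hx).hasFDerivWithinAt
  have hAe : ∀ x ∈ Metric.ball x₀ r, ∃ B : E 2 ≃L[ℝ] E 2, (B : E 2 →L[ℝ] E 2) = A x := by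
    intro x hx
    have hinj : Function.Injective (A x).toLinearMap := by
      rw [← LinearMap.ker_eq_bot, LinearMap.ker_eq_bot']
      intro v hv
      have hv' : A x v = 0 := hv
      exact hab x hx v (by rw [← hA0, hv']; rfl) (by rw [← hA1, hv']; rfl)
    refine ⟨(LinearEquiv.ofInjectiveEndo _ hinj).toContinuousLinearEquiv, ?_⟩
    ext v : 1
    rfl
  have hΦs : ∀ x ∈ Metric.ball x₀ r, ContDiffAt ℝ ∞ Φ x := fun x hx =>
    hΦ.contDiffAt (Metric.isOpen_ball.mem_nhds hx)
  have hx₀ := Metric.mem_ball_self hr (x := x₀)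
  obtain ⟨B₀, hB₀⟩ := hAe x₀ hx₀
  have hd₀ : HasFDerivAt Φ (B₀ : E 2 →L[ℝ] E 2) x₀ := hB₀ ▸ hΦd x₀ hx₀
  -- The inverse function theorem inverts `Φ = (s, t)` near `x₀`; restricting the inverse to a
  -- square then gives `Ψ`.
  let R := ((hΦs x₀ hx₀).toOpenPartialHomeomorph Φ hd₀ (by simp)).restrOpen
    (Metric.ball x₀ r) Metric.isOpen_ball
  have hRΦ : ∀ x, R x = Φ x := fun x => rfl
  have hxR : x₀ ∈ R.source :=
    ⟨(hΦs x₀ hx₀).mem_toOpenPartialHomeomorph_source hd₀ (by simp), hx₀⟩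
  obtain ⟨δ, hδ, hsub⟩ := exists_square_subset (R.open_target.mem_nhds (R.map_source hxR))
  let Ψ := (R.symm.restrOpen (square (R x₀) δ) (isOpen_square _ _)).symm
  have hΨt : Ψ.target = square (R x₀) δ := Set.inter_eq_right.2 hsub
  have hΨs : Ψ.source ⊆ R.source := by
    intro x hx
    have h1 := Ψ.map_source hx
    have h2 : Ψ.symm (Ψ x) ∈ R.source := R.symm.map_source h1.1
    rwa [Ψ.left_inv hx] at h2
  have hΨb : Ψ.source ⊆ Metric.ball x₀ r := fun x hx => (hΨs hx).2
  have hΨΦ : ∀ x, Ψ x = Φ x := fun x => rfl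
  have hinv : ContDiffOn ℝ ∞ Ψ.symm Ψ.target := by
    intro z hz
    have hz' := hΨb (Ψ.symm.map_source hz)
    obtain ⟨B, hB⟩ := hAe _ hz'
    exact (Ψ.contDiffAt_symm hz (f₀' := B) (hB ▸ hΦd _ hz') (hΦs _ hz')).contDiffWithinAt
  refine ⟨Ψ, R x₀, δ, hδ, ?_, ?_, hΨb, hΨt, hinv, ?_⟩
  · rw [contDiffGroupoid, mem_groupoid_of_pregroupoid]
    simp only [contDiffPregroupoid, modelWithCornersSelf_coe, modelWithCornersSelf_coe_symm,
      Function.id_comp, Function.comp_id, Set.preimage_id, Set.range_id, Set.inter_univ]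
    exact ⟨hΦ.mono hΨb, hinv⟩
  · have h1 : R x₀ ∈ Ψ.target := hΨt ▸ mem_square_self _ hδ
    have h2 := Ψ.symm.map_source h1
    have h3 : Ψ.symm (R x₀) = x₀ := R.left_inv hxR
    exact h3 ▸ h2
  · intro z hz v
    have hz' := hΨb (Ψ.symm.map_source hz)
    have hdz : DifferentiableAt ℝ Ψ.symm z :=
      (hinv.contDiffAt (Ψ.open_target.mem_nhds hz)).differentiableAt (by simp)
    have hcomp := (hΦd _ hz').comp z hdz.hasFDerivAt
    have hid : HasFDerivAt (Φ ∘ Ψ.symm) (ContinuousLinearMap.id ℝ (E 2)) z := by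
      refine (hasFDerivAt_id z).congr_of_eventuallyEq ?_
      filter_upwards [Ψ.open_target.mem_nhds hz] with y hy
      exact Ψ.right_inv hy
    have huniq := hcomp.unique hid
    have hv : A (Ψ.symm z) (fderiv ℝ Ψ.symm z v) = v := congrArg (fun T => T v) huniq
    exact ⟨by rw [← hA0, hv], by rw [← hA1, hv]⟩

/-- Composing a chart with a local diffeomorphism of the model space gives a chart. -/
theorem trans_mem_maximalAtlas {S : Type*} [TopologicalSpace S] [ChartedSpace (E 2) S]
    {e : OpenPartialHomeomorph S (E 2)} (he : e ∈ IsManifold.maximalAtlas (𝓡 2) ∞ S)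
    {Ψ : OpenPartialHomeomorph (E 2) (E 2)} (hΨ : Ψ ∈ contDiffGroupoid ∞ (𝓡 2)) :
    e.trans Ψ ∈ IsManifold.maximalAtlas (𝓡 2) ∞ S := by
  rw [IsManifold.mem_maximalAtlas_iff] at he ⊢
  intro e' he'
  obtain ⟨h1, h2⟩ := he e' he'
  refine ⟨?_, ?_⟩
  · rw [OpenPartialHomeomorph.trans_symm_eq_symm_trans_symm, OpenPartialHomeomorph.trans_assoc]
    exact (contDiffGroupoid ∞ (𝓡 2)).trans ((contDiffGroupoid ∞ (𝓡 2)).symm hΨ) h1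
  · rw [← OpenPartialHomeomorph.trans_assoc]
    exact (contDiffGroupoid ∞ (𝓡 2)).trans h2 hΨ

end Rectify

/-! ### Curvature of a warped metric -/

section WarpedMetric

/-- The metric `du² + w(u)² dv²`. -/
def warpedMetric (w : ℝ → ℝ) (y : E 2) : Matrix (Fin 2) (Fin 2) ℝ :=
  !![1, 0; 0, w (y 0) ^ 2]

theorem pd_congr {n : ℕ} {h k : E n → ℝ} {y : E n} (i : Fin n) (hk : h =ᶠ[𝓝 y] k) :
    pd i h y = pd i k y := by
  rw [pd, pd, hk.fderiv_eq]

theorem christoffel_congr {n : ℕ} {g g' : E n → Matrix (Fin n) (Fin n) ℝ} {y : E n}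
    (h : g =ᶠ[𝓝 y] g') (k i j : Fin n) : christoffel g k i j =ᶠ[𝓝 y] christoffel g' k i j := by
  filter_upwards [h.eventually_nhds] with z hz
  have hab : ∀ a b : Fin n, (fun z => g z a b) =ᶠ[𝓝 z] fun z => g' z a b := fun a b => by
    filter_upwards [hz] with w hw
    rw [hw]
  simp only [christoffel]
  rw [hz.self_of_nhds]
  simp only [pd_congr _ (hab _ _)]

/-- Curvature depends only on the germ of the metric, so the induced metric may be replaced by its
warped model near a point. -/
theorem gaussCurvature_congr {g g' : E 2 → Matrix (Fin 2) (Fin 2) ℝ} {y : E 2}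
    (h : g =ᶠ[𝓝 y] g') : gaussCurvature g y = gaussCurvature g' y := by
  simp only [gaussCurvature, curvatureTensor, h.self_of_nhds, pd_congr _ (christoffel_congr h _ _ _),
    (christoffel_congr h _ _ _).self_of_nhds]

theorem pd_zero_comp {h : ℝ → ℝ} {h' : ℝ} {y : E 2} (hh : HasDerivAt h h' (y 0)) :
    pd 0 (fun z => h (z 0)) y = h' := by
  have := hh.comp_hasFDerivAt y (EuclideanSpace.proj (𝕜 := ℝ) (0 : Fin 2)).hasFDerivAt
  rw [pd]
  erw [this.fderiv]
  simp

theorem pd_one_comp {h : ℝ → ℝ} {h' : ℝ} {y : E 2} (hh : HasDerivAt h h' (y 0)) :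
    pd 1 (fun z => h (z 0)) y = 0 := by
  have := hh.comp_hasFDerivAt y (EuclideanSpace.proj (𝕜 := ℝ) (0 : Fin 2)).hasFDerivAt
  rw [pd]
  erw [this.fderiv]
  simp

theorem pd_const {n : ℕ} (i : Fin n) (c : ℝ) (y : E n) : pd i (fun _ => c) y = 0 := by
  simp [pd]

variable {w w₁ : ℝ → ℝ} {y : E 2}

theorem christoffel_warpedMetric (hw : HasDerivAt w (w₁ (y 0)) (y 0)) (h0 : w (y 0) ≠ 0)
    (k i j : Fin 2) : christoffel (warpedMetric w) k i j y =
      (![!![0, 0; 0, -(w (y 0) * w₁ (y 0))],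
        !![0, w₁ (y 0) / w (y 0); w₁ (y 0) / w (y 0), 0]] : Fin 2 → Matrix (Fin 2) (Fin 2) ℝ)
        k i j := by
  have hinv : (warpedMetric w y)⁻¹ = !![1, 0; 0, (w (y 0) ^ 2)⁻¹] := by
    refine Matrix.inv_eq_right_inv ?_
    ext a b
    fin_cases a <;> fin_cases b <;> simp [warpedMetric, Matrix.mul_apply, h0]
  have h2 : HasDerivAt (fun t => w t ^ 2) (2 * w (y 0) * w₁ (y 0)) (y 0) := by
    have := hw.fun_pow 2
    simpa using this
  have p0 := pd_zero_comp h2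
  have p1 := pd_one_comp h2
  simp only [christoffel, hinv, Fin.sum_univ_two]
  fin_cases k <;> fin_cases i <;> fin_cases j <;>
    simp [warpedMetric, pd_const, p0, p1] <;> field_simp

/-- The curvature of `du² + w(u)² dv²` is `-w'' / w`. -/
theorem gaussCurvature_warpedMetric {w₂ : ℝ} (hw : ∀ᶠ t in 𝓝 (y 0), HasDerivAt w (w₁ t) t)
    (hw₁ : HasDerivAt w₁ w₂ (y 0)) (h0 : w (y 0) ≠ 0) :
    gaussCurvature (warpedMetric w) y = -(w₂ / w (y 0)) := by
  have hy : Filter.Tendsto (fun z : E 2 => z 0) (𝓝 y) (𝓝 (y 0)) :=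
    (EuclideanSpace.proj (𝕜 := ℝ) (0 : Fin 2)).continuous.continuousAt
  have hw0 : ∀ᶠ z : E 2 in 𝓝 y, HasDerivAt w (w₁ (z 0)) (z 0) ∧ w (z 0) ≠ 0 :=
    hy.eventually (hw.and (hw.self_of_nhds.continuousAt.eventually_ne h0))
  -- The Christoffel symbols are differentiated once more, hence their formula is needed near `y`.
  have hc := fun k i j : Fin 2 => hw0.mono fun z hz => christoffel_warpedMetric hz.1 hz.2 k i j
  have hc' : ∀ k i j, christoffel (warpedMetric w) k i j =ᶠ[𝓝 y] _ := hc
  have d0 : HasDerivAt (fun t => -(w t * w₁ t)) (-(w₁ (y 0) * w₁ (y 0) + w (y 0) * w₂)) (y 0) :=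
    (hw.self_of_nhds.mul hw₁).neg
  have p0 := pd_zero_comp d0
  simp only [gaussCurvature, curvatureTensor, Fin.sum_univ_two, pd_congr _ (hc' _ _ _),
    (hc' _ _ _).self_of_nhds]
  simp [warpedMetric, pd_const, p0]
  field_simp
  ring

end WarpedMetric

/-! ### Functions of `u` alone on a square -/

section FunctionsOnSquare

theorem toLp_eq_smul_single (u t : ℝ) : (WithLp.toLp 2 ![u, t] : E 2) =
    u • EuclideanSpace.single 0 1 + t • EuclideanSpace.single 1 1 := by
  ext i
  fin_cases i <;> simp

theorem hasDerivAt_toLp_left (u t : ℝ) :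
    HasDerivAt (fun u : ℝ => (WithLp.toLp 2 ![u, t] : E 2)) (EuclideanSpace.single 0 1) u := by
  have h := ((hasDerivAt_id u).smul_const (EuclideanSpace.single 0 1 : E 2)).add_const
    (t • EuclideanSpace.single 1 1)
  rw [one_smul] at h
  exact h.congr_of_eventuallyEq (.of_forall fun s => toLp_eq_smul_single s t)

theorem hasDerivAt_toLp_right (u t : ℝ) :
    HasDerivAt (fun t : ℝ => (WithLp.toLp 2 ![u, t] : E 2)) (EuclideanSpace.single 1 1) t := by
  have h := ((hasDerivAt_id t).smul_const (EuclideanSpace.single 1 1 : E 2)).const_add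
    (u • EuclideanSpace.single 0 1)
  rw [one_smul] at h
  exact h.congr_of_eventuallyEq (.of_forall fun s => toLp_eq_smul_single u s)

variable {c : E 2} {δ : ℝ} {G g : E 2 → ℝ}

theorem toLp_mem_square {u : ℝ} (hu : u ∈ Set.Ioo (c 0 - δ) (c 0 + δ)) {t : ℝ}
    (ht : t ∈ Set.Ioo (c 1 - δ) (c 1 + δ)) : (WithLp.toLp 2 ![u, t] : E 2) ∈ square c δ := by
  intro i
  fin_cases i
  · exact hu
  · exact ht

theorem toLp_eta (z : E 2) : (WithLp.toLp 2 ![z 0, z 1] : E 2) = z := by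
  ext i
  fin_cases i <;> rfl

/-- A function on a square whose differential is a multiple of `du` depends only on `u`. -/
theorem eq_of_hasFDerivAt_smul_proj (hδ : 0 < δ) (hG : ∀ z ∈ square c δ,
    HasFDerivAt G (g z • (EuclideanSpace.proj 0 : E 2 →L[ℝ] ℝ)) z) {z : E 2}
    (hz : z ∈ square c δ) : G z = G (WithLp.toLp 2 ![z 0, c 1]) := by
  have hd : ∀ t ∈ Set.Ioo (c 1 - δ) (c 1 + δ),
      HasDerivAt (fun t : ℝ => G (WithLp.toLp 2 ![z 0, t])) 0 t := by
    intro t ht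
    have := (hG _ (toLp_mem_square (hz 0) ht)).comp_hasDerivAt t (hasDerivAt_toLp_right (z 0) t)
    exact this.congr_deriv (by simp)
  have := isOpen_Ioo.is_const_of_deriv_eq_zero isPreconnected_Ioo
    (fun t ht => (hd t ht).differentiableAt.differentiableWithinAt) (fun t ht => (hd t ht).deriv)
    (hz 1) (mem_square_self c hδ 1)
  simpa only [toLp_eta] using this

/-- The `u`-derivative at `z` can be taken along the central line, as `G` does not depend on `v`. By
uniqueness of derivatives the factor `g` then depends only on `u` as well. -/
theorem hasDerivAt_of_hasFDerivAt_smul_proj (hδ : 0 < δ) (hG : ∀ z ∈ square c δ,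
    HasFDerivAt G (g z • (EuclideanSpace.proj 0 : E 2 →L[ℝ] ℝ)) z) {z : E 2}
    (hz : z ∈ square c δ) :
    HasDerivAt (fun u : ℝ => G (WithLp.toLp 2 ![u, c 1])) (g z) (z 0) := by
  have h1 : HasDerivAt (fun u : ℝ => G (WithLp.toLp 2 ![u, z 1])) (g z) (z 0) := by
    have h := hG z hz
    have := HasFDerivAt.comp_hasDerivAt_of_eq (z 0) h (hasDerivAt_toLp_left (z 0) (z 1))
      (toLp_eta z).symm
    exact this.congr_deriv (by simp)
  refine h1.congr_of_eventuallyEq ?_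
  filter_upwards [isOpen_Ioo.mem_nhds (hz 0)] with u hu
  exact (eq_of_hasFDerivAt_smul_proj hδ hG (toLp_mem_square hu (hz 1))).symm

end FunctionsOnSquare

/-! ### Closedness of the rescaled coframe and the metric in its coordinates -/

section ClosedForms

theorem fderiv_smul_form {g : E 2 → ℝ} {η : E 2 → E 2 →L[ℝ] ℝ} {x : E 2}
    (hg : DifferentiableAt ℝ g x) (hη : DifferentiableAt ℝ η x) (u v : E 2) :
    fderiv ℝ (fun x => g x • η x) x u v = g x * fderiv ℝ η x u v + fderiv ℝ g x u * η x v := by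
  rw [fderiv_fun_smul hg hη]
  simp

variable {M : Type*} [TopologicalSpace M] [ChartedSpace (E 3) M]
  [Bundle.RiemannianBundle (fun x : M => TangentSpace (𝓡 3) x)]
  {S : Type*} [TopologicalSpace S]
  {ι : S → M} {θ f : S → ℝ} {e : OpenPartialHomeomorph S (E 2)}
  {α β : E 2 → E 2 →L[ℝ] ℝ} {x : E 2}

namespace StructureEquationsAt

variable (h : StructureEquationsAt ι θ f e α β x)
  (hθ : DifferentiableAt ℝ (fun y => θ (e.symm y)) x)
include h hθ

theorem fderiv_angle (v : E 2) : fderiv ℝ (fun y => θ (e.symm y)) x v =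
    f (e.symm x) * Real.cos (θ (e.symm x)) * α x v / Real.sin (θ (e.symm x)) := by
  have h1 := h.fderiv_cos v
  rw [_root_.fderiv_cos hθ] at h1
  have := h.sin_pos.ne'
  simp only [smul_apply, smul_eq_mul] at h1
  field_simp
  linarith

/-- `arsinh (tan θ)` has derivative `1 / cos θ` in `θ`, which cancels the cosine in `dθ = f cos θ α
/ sin θ`. -/
theorem fderiv_arsinh_tan (hc : 0 < Real.cos (θ (e.symm x))) :
    HasFDerivAt (fun y => Real.arsinh (Real.tan (θ (e.symm y))))
      (f (e.symm x) • (Real.sin (θ (e.symm x)))⁻¹ • α x) x := by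
  have h1 := (Real.hasDerivAt_arsinh (Real.tan (θ (e.symm x)))).comp_hasFDerivAt x
    ((Real.hasDerivAt_tan hc.ne').comp_hasFDerivAt x hθ.hasFDerivAt)
  refine h1.congr_fderiv ?_
  ext v
  simp only [smul_apply, smul_eq_mul, h.fderiv_angle hθ v, Real.inv_sqrt_one_add_tan_sq hc]
  field_simp

/-- `α` is closed and `d(1 / sin θ)` is a multiple of `α`, so the wedge product vanishes. -/
theorem fderiv_coframe_left_comm (u v : E 2) :
    fderiv ℝ (fun x => (Real.sin (θ (e.symm x)))⁻¹ • α x) x u v =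
      fderiv ℝ (fun x => (Real.sin (θ (e.symm x)))⁻¹ • α x) x v u := by
  have hs := h.sin_pos.ne'
  have hg : HasFDerivAt (fun y => (Real.sin (θ (e.symm y)))⁻¹) _ x :=
    (hasDerivAt_inv hs).comp_hasFDerivAt x hθ.hasFDerivAt.sin
  have hα := h.smooth_left.differentiableAt (by simp)
  rw [fderiv_smul_form hg.differentiableAt hα, fderiv_smul_form hg.differentiableAt hα, hg.fderiv,
    h.fderiv_left u v]
  simp only [smul_apply, smul_eq_mul, h.fderiv_angle hθ]
  ring

/-- `cot θ` is an integrating factor for `β`: `d(cot θ) = -(f cos θ / sin³ θ) α` cancels `cot θ dβ =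
(f cos θ / sin³ θ) α ∧ β`. -/
theorem fderiv_coframe_right_comm (u v : E 2) :
    fderiv ℝ (fun x => (Real.cos (θ (e.symm x)) / Real.sin (θ (e.symm x))) • β x) x u v =
      fderiv ℝ (fun x => (Real.cos (θ (e.symm x)) / Real.sin (θ (e.symm x))) • β x) x v u := by
  have hs := h.sin_pos.ne'
  have hg : HasFDerivAt (fun y => Real.cos (θ (e.symm y)) / Real.sin (θ (e.symm y))) _ x :=
    HasDerivAt.comp_hasFDerivAt (h₂ := fun t => Real.cos t / Real.sin t) x
      ((Real.hasDerivAt_cos _).fun_div (Real.hasDerivAt_sin _) hs) hθ.hasFDerivAt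
  have hβ := h.smooth_right.differentiableAt (by simp)
  rw [fderiv_smul_form hg.differentiableAt hβ, fderiv_smul_form hg.differentiableAt hβ, hg.fderiv]
  have h2 := h.fderiv_right u v
  simp only [smul_apply, smul_eq_mul, h.fderiv_angle hθ]
  have h3 := Real.sin_sq_add_cos_sq (θ (e.symm x))
  have h4 : -Real.sin (θ (e.symm x)) * Real.sin (θ (e.symm x))
      - Real.cos (θ (e.symm x)) * Real.cos (θ (e.symm x)) = -1 := by linarith
  rw [h4, ← sub_eq_zero, eq_add_of_sub_eq h2]
  field_simp
  ring

end StructureEquationsAt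

variable [ChartedSpace (E 2) S]

/-- The induced metric in the coordinates given by the coframe. -/
theorem inducedMetric_trans (hι : ContMDiff (𝓡 2) (𝓡 3) ∞ ι)
    (he : e ∈ IsManifold.maximalAtlas (𝓡 2) ∞ S) {Ψ : OpenPartialHomeomorph (E 2) (E 2)} {z : E 2}
    (hd : DifferentiableAt ℝ Ψ.symm z) (hz : Ψ.symm z ∈ e.target)
    (h : StructureEquationsAt ι θ f e α β (Ψ.symm z))
    (hc : 0 < Real.cos (θ (e.symm (Ψ.symm z))))
    (hΨ : ∀ v, ((Real.sin (θ (e.symm (Ψ.symm z))))⁻¹ • α (Ψ.symm z)) (fderiv ℝ Ψ.symm z v) = v 0 ∧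
      ((Real.cos (θ (e.symm (Ψ.symm z))) / Real.sin (θ (e.symm (Ψ.symm z)))) • β (Ψ.symm z))
        (fderiv ℝ Ψ.symm z v) = v 1)
    {w : ℝ → ℝ} (hw : w (z 0) = Real.tan (θ (e.symm (Ψ.symm z)))) :
    inducedMetric ι (e.trans Ψ) z = warpedMetric w z := by
  have hj : MDifferentiableAt (𝓡 2) (𝓡 3) (ι ∘ e.symm) (Ψ.symm z) :=
    (contMDiffAt_comp_symm hι he hz).mdifferentiableAt (by simp)
  have hm : ∀ v : E 2, mfderiv (𝓡 2) (𝓡 3) (ι ∘ (e.trans Ψ).symm) z v =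
      mfderiv (𝓡 2) (𝓡 3) (ι ∘ e.symm) (Ψ.symm z) (fderiv ℝ Ψ.symm z v) := by
    intro v
    have := mfderiv_comp_apply z hj hd.mdifferentiableAt v
    rw [mfderiv_eq_fderiv] at this
    exact this
  have hs := h.sin_pos
  have key : ∀ u v : E 2, (inner ℝ (mfderiv (𝓡 2) (𝓡 3) (ι ∘ (e.trans Ψ).symm) z u)
      (mfderiv (𝓡 2) (𝓡 3) (ι ∘ (e.trans Ψ).symm) z v) : ℝ) =
      u 0 * v 0 + w (z 0) ^ 2 * (u 1 * v 1) := by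
    intro u v
    rw [hm, hm]
    refine (h.metric _ _).trans ?_
    rw [← (hΨ u).1, ← (hΨ u).2, ← (hΨ v).1, ← (hΨ v).2, hw, Real.tan_eq_sin_div_cos]
    simp only [smul_apply, smul_eq_mul]
    field_simp
  ext i k
  rw [inducedMetric, Matrix.of_apply, key]
  fin_cases i <;> fin_cases k <;> simp [warpedMetric]

end ClosedForms

/-! ### The isoparametric chart -/

section IsoparametricChart

variable {M : Type*} [TopologicalSpace M] [ChartedSpace (E 3) M] [IsManifold (𝓡 3) ∞ M]
  [Bundle.RiemannianBundle (fun x : M => TangentSpace (𝓡 3) x)]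
  [IsContMDiffRiemannianBundle (𝓡 3) ∞ (E 3) (fun x : M => TangentSpace (𝓡 3) x)]
  {nabla : CovariantDerivative (𝓡 3) (E 3) (fun x : M => TangentSpace (𝓡 3) x)}
  {S : Type*} [TopologicalSpace S] [ChartedSpace (E 2) S]
  {ι : S → M} {N V : (p : S) → TangentSpace (𝓡 3) (ι p)} {θ f : S → ℝ}

/-- Around a point where the angle is not zero there are coordinates `(u, v)` in which
`F = arsinh (tan θ)` satisfies `dF = f du` and the metric is `du² + sinh² F dv²`. -/
theorem exists_isoparametric_chart (hnabla : IsLeviCivita nabla)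
    (hι : Manifold.IsImmersion (𝓡 2) (𝓡 3) ∞ ι)
    (hN : IsUnitNormal ι N) (hPA : IsPrescribedAngle ι N V θ)
    (hV : IsAntiTorquedAlong nabla ι V f) (hgeo : IsTotallyGeodesic nabla ι N)
    (hcos : ∀ q, 0 < Real.cos (θ q)) {p : S} (hp : θ p ≠ 0) :
    ∃ e ∈ IsManifold.maximalAtlas (𝓡 2) ∞ S, p ∈ e.source ∧ ∃ (c : E 2) (δ : ℝ), 0 < δ ∧
      e.target = square c δ ∧ ∀ z ∈ square c δ, 0 < Real.sin (θ (e.symm z)) ∧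
        HasFDerivAt (fun z => Real.arsinh (Real.tan (θ (e.symm z))))
          (f (e.symm z) • (EuclideanSpace.proj 0 : E 2 →L[ℝ] ℝ)) z ∧
        ∀ w : ℝ → ℝ, w (z 0) = Real.tan (θ (e.symm z)) →
          inducedMetric ι e z = warpedMetric w z := by
  obtain ⟨e, ψ, L, hpe, h⟩ := exists_isAdapted hι p
  have hθp : 0 < Real.sin (θ (e.symm (e p))) := by
    rw [e.left_inv hpe]
    have := hPA.angle_mem p
    exact Real.sin_pos_of_pos_of_lt_pi (this.1.lt_of_ne' hp)
      (this.2.trans_lt (half_lt_self Real.pi_pos))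
  have hpt := e.map_source hpe
  obtain ⟨α, β, hαβ⟩ := eventually_structureEquationsAt hnabla h hι.contMDiff hN hPA hV hgeo
    hpt hθp
  obtain ⟨r, hr, hball⟩ := Metric.mem_nhds_iff.1 (hαβ.and (e.open_target.mem_nhds hpt))
  have hst : ∀ x ∈ Metric.ball (e p) r, StructureEquationsAt ι θ f e α β x :=
    fun x hx => (hball hx).1
  have htg : ∀ x ∈ Metric.ball (e p) r, x ∈ e.target := fun x hx => (hball hx).2
  have hθs : ∀ x ∈ Metric.ball (e p) r, ContDiffAt ℝ ∞ (fun y => θ (e.symm y)) x :=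
    fun x hx => contDiffAt_comp_symm hPA.smooth_angle h.mem_atlas (htg x hx)
  have hθd : ∀ x ∈ Metric.ball (e p) r, DifferentiableAt ℝ (fun y => θ (e.symm y)) x :=
    fun x hx => (hθs x hx).differentiableAt (by simp)
  -- `du = α / sin θ` and `dv = cot θ β`; positivity of `cos θ` keeps the second form from
  -- degenerating.
  obtain ⟨Ψ, c, δ, hδ, hΨ, hpΨ, hΨs, hΨt, hΨi, hΨd⟩ := exists_chart_of_closed_coframe
    (a := fun x => (Real.sin (θ (e.symm x)))⁻¹ • α x)
    (b := fun x => (Real.cos (θ (e.symm x)) / Real.sin (θ (e.symm x))) • β x) hr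
    (fun x hx => ((hθs x hx).sin.inv (hst x hx).sin_pos.ne').smul (hst x hx).smooth_left)
    (fun x hx => ((hθs x hx).cos.div (hθs x hx).sin (hst x hx).sin_pos.ne').smul
      (hst x hx).smooth_right)
    (fun x hx => (hst x hx).fderiv_coframe_left_comm (hθd x hx))
    (fun x hx => (hst x hx).fderiv_coframe_right_comm (hθd x hx))
    (fun x hx v h1 h2 => (hst x hx).nondegenerate v
      ((mul_eq_zero.1 h1).resolve_left (inv_ne_zero (hst x hx).sin_pos.ne'))
      ((mul_eq_zero.1 h2).resolve_left (div_ne_zero (hcos _).ne' (hst x hx).sin_pos.ne')))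
  have hzb : ∀ z ∈ square c δ, Ψ.symm z ∈ Metric.ball (e p) r := fun z hz =>
    hΨs (Ψ.map_target (hΨt.symm ▸ hz))
  refine ⟨e.trans Ψ, trans_mem_maximalAtlas h.mem_atlas hΨ, ⟨hpe, hpΨ⟩, c, δ, hδ, ?_, ?_⟩
  · rw [OpenPartialHomeomorph.trans_target, hΨt]
    exact Set.inter_eq_left.2 fun z hz => htg _ (hzb z hz)
  · intro z hz
    have hzt : z ∈ Ψ.target := hΨt.symm ▸ hz
    have hx := hzb z hz
    have hd : DifferentiableAt ℝ Ψ.symm z :=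
      (hΨi.contDiffAt (Ψ.open_target.mem_nhds hzt)).differentiableAt (by simp)
    refine ⟨(hst _ hx).sin_pos, ?_, fun w hw => inducedMetric_trans hι.contMDiff h.mem_atlas hd
      (htg _ hx) (hst _ hx) (hcos _) (hΨd z hzt) hw⟩
    refine (((hst _ hx).fderiv_arsinh_tan (hθd _ hx) (hcos _)).comp z hd.hasFDerivAt).congr_fderiv ?_
    ext v
    exact congrArg (f (e.symm (Ψ.symm z)) * ·) (hΨd z hzt v).1

end IsoparametricChart

/-! ### Hyperbolic expressions for the angle and the curvature -/

/-- `cosh (arsinh (tan t)) = √(1 + tan² t) = 1 / cos t` when `cos t > 0`. -/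
theorem arccos_sech_arsinh_tan {t : ℝ} (h0 : 0 ≤ t) (hc : 0 < Real.cos t) (ht : t ≤ Real.pi) :
    Real.arccos (sech (Real.arsinh (Real.tan t))) = t := by
  rw [sech, Real.cosh_arsinh, one_div, Real.inv_sqrt_one_add_tan_sq hc, Real.arccos_cos h0 ht]

/-- The curvature of `du² + sinh² F dv²`. -/
theorem gaussCurvature_warpedMetric_sinh {F φ : ℝ → ℝ} {y : E 2}
    (hF : ∀ᶠ t in 𝓝 (y 0), HasDerivAt F (φ t) t) (hφ : DifferentiableAt ℝ φ (y 0))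
    (h0 : F (y 0) ≠ 0) : gaussCurvature (warpedMetric fun t => Real.sinh (F t)) y =
      -(deriv (deriv F) (y 0) * coth (F (y 0)) + deriv F (y 0) ^ 2) := by
  have hd : deriv F =ᶠ[𝓝 (y 0)] φ := hF.mono fun t ht => ht.deriv
  have hs : Real.sinh (F (y 0)) ≠ 0 := Real.sinh_ne_zero.2 h0
  rw [gaussCurvature_warpedMetric (w₁ := fun t => Real.cosh (F t) * φ t)
    (hF.mono fun t ht => ht.sinh) (hF.self_of_nhds.cosh.mul hφ.hasDerivAt) hs,
    hd.deriv_eq, hd.self_of_nhds, coth]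
  field_simp
  ring

end PASurface

end

/-! ### The main theorem -/

theorem mainTheorem4
    {M : Type*} [TopologicalSpace M] [ChartedSpace (PASurface.E 3) M] [IsManifold (𝓡 3) ∞ M]
    [Bundle.RiemannianBundle (fun x : M => TangentSpace (𝓡 3) x)]
    [IsContMDiffRiemannianBundle (𝓡 3) ∞ (PASurface.E 3) (fun x : M => TangentSpace (𝓡 3) x)]
    (nabla : CovariantDerivative (𝓡 3) (PASurface.E 3) (fun x : M => TangentSpace (𝓡 3) x))
    (hnabla : PASurface.IsLeviCivita nabla)
    {S : Type*} [TopologicalSpace S] [ConnectedSpace S] [ChartedSpace (PASurface.E 2) S]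
    [IsManifold (𝓡 2) ∞ S]
    (ι : S → M) (hι : Manifold.IsImmersion (𝓡 2) (𝓡 3) ∞ ι)
    (N V : (p : S) → TangentSpace (𝓡 3) (ι p)) (θ f : S → ℝ)
    (hN : PASurface.IsUnitNormal ι N)
    (hPA : PASurface.IsPrescribedAngle ι N V θ)
    (hV : PASurface.IsAntiTorquedAlong nabla ι V f)
    (hgeo : PASurface.IsTotallyGeodesic nabla ι N)
    (hθ : ¬ ∃ c : ℝ, ∀ p, θ p = c) :
    ∀ p : S, θ p ≠ 0 → ∃ e ∈ IsManifold.maximalAtlas (𝓡 2) ∞ S, p ∈ e.source ∧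
      ∃ (a b : ℝ) (φ F : ℝ → ℝ),
        (fun q => e q 0) '' e.source = Set.Ioo a b ∧
        ContDiffOn ℝ ∞ φ (Set.Ioo a b) ∧
        (∃ u₀ ∈ Set.Ioo a b, ∃ c : ℝ, ∀ u ∈ Set.Ioo a b, F u = (∫ t in u₀..u, φ t) + c) ∧
        (∀ u ∈ Set.Ioo a b, F u ≠ 0) ∧
        ∀ q ∈ e.source,
          f q = φ (e q 0) ∧
          θ q = Real.arccos (PASurface.sech (F (e q 0))) ∧
          PASurface.intrinsicCurvature ι e q =
            -(deriv (deriv F) (e q 0) * PASurface.coth (F (e q 0)) + deriv F (e q 0) ^ 2) := by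

  intro p hp
  obtain ⟨e, he, hpe, c, δ, hδ, het, H⟩ := PASurface.exists_isoparametric_chart hnabla hι hN hPA hV
    hgeo (PASurface.cos_angle_pos hnabla hι hN hPA hV hgeo hθ) hp
  have hcos := PASurface.cos_angle_pos hnabla hι hN hPA hV hgeo hθ
  let J : Set ℝ := Set.Ioo (c 0 - δ) (c 0 + δ)
  -- `F` and `φ` are sampled on the horizontal line through the center of the square.
  let γ : ℝ → PASurface.E 2 := fun u => WithLp.toLp 2 ![u, c 1]
  let F : ℝ → ℝ := fun u => Real.arsinh (Real.tan (θ (e.symm (γ u))))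
  let φ : ℝ → ℝ := fun u => f (e.symm (γ u))
  have hc := PASurface.mem_square_self c hδ
  have hγ : ∀ u ∈ J, γ u ∈ PASurface.square c δ := fun u hu => PASurface.toLp_mem_square hu (hc 1)
  have hG := fun z hz => (H z hz).2.1
  have hF : ∀ u ∈ J, HasDerivAt F (φ u) u := fun u hu =>
    PASurface.hasDerivAt_of_hasFDerivAt_smul_proj hδ hG (hγ u hu)
  have hφ : ContDiffOn ℝ ∞ φ J := by
    have hγs : ContDiff ℝ ∞ γ := by
      rw [contDiff_euclidean]
      intro i
      fin_cases i
      · exact contDiff_id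
      · exact contDiff_const
    exact fun u hu => (ContDiffAt.comp u (PASurface.contDiffAt_comp_symm hV.smooth_potential he
      (het ▸ hγ u hu)) hγs.contDiffAt).contDiffWithinAt
  have hF0 : ∀ u ∈ J, F u ≠ 0 := by
    intro u hu
    refine (Real.arsinh_pos_iff.2 ?_).ne'
    rw [Real.tan_eq_sin_div_cos]
    exact div_pos (H _ (hγ u hu)).1 (hcos _)
  have hFz : ∀ z ∈ PASurface.square c δ, F (z 0) = Real.arsinh (Real.tan (θ (e.symm z))) :=
    fun z hz => (PASurface.eq_of_hasFDerivAt_smul_proj hδ hG hz).symm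
  -- With `u₀ = c 0` and constant `F (c 0)`, the integral formula is the fundamental theorem of
  -- calculus for `F' = φ`.
  refine ⟨e, he, hpe, c 0 - δ, c 0 + δ, φ, F, ?_, hφ, ⟨c 0, hc 0, F (c 0), ?_⟩, hF0, ?_⟩
  · refine Set.Subset.antisymm ?_ fun u hu => ⟨e.symm (γ u), ?_, ?_⟩
    · rintro _ ⟨q, hq, rfl⟩
      have : e q ∈ PASurface.square c δ := het ▸ e.map_source hq
      exact this 0
    · exact e.map_target (het ▸ hγ u hu)
    · show e (e.symm (γ u)) 0 = u
      rw [e.right_inv (het ▸ hγ u hu)]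
      rfl
  · intro u hu
    have hsub : Set.uIcc (c 0) u ⊆ J := Set.ordConnected_Ioo.uIcc_subset (hc 0) hu
    rw [intervalIntegral.integral_eq_sub_of_hasDerivAt (fun t ht => hF t (hsub ht))
      (hφ.continuousOn.mono hsub).intervalIntegrable, sub_add_cancel]
  · intro q hq
    have hz : e q ∈ PASurface.square c δ := het ▸ e.map_source hq
    have hzJ : e q 0 ∈ J := hz 0
    refine ⟨?_, ?_, ?_⟩
    -- The derivative of `F` at `e q 0` is `f q` when read off at `e q`, and `φ (e q 0)` when read
    -- off on the central line.
    · have h1 := PASurface.hasDerivAt_of_hasFDerivAt_smul_proj hδ hG hz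
      have h2 := h1.unique (hF _ hzJ)
      simpa only [e.left_inv hq] using h2
    · rw [hFz _ hz, e.left_inv hq, PASurface.arccos_sech_arsinh_tan (hPA.angle_mem q).1 (hcos q)
        ((hPA.angle_mem q).2.trans (half_le_self Real.pi_pos.le))]
    · rw [← PASurface.gaussCurvature_warpedMetric_sinh
        (Filter.eventually_of_mem (isOpen_Ioo.mem_nhds hzJ) hF)
        ((hφ.contDiffAt (isOpen_Ioo.mem_nhds hzJ)).differentiableAt (by simp)) (hF0 _ hzJ)]
      refine PASurface.gaussCurvature_congr ?_
      filter_upwards [(PASurface.isOpen_square c δ).mem_nhds hz] with z hz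
      -- The warping function is `sinh F = tan θ`.
      refine (H z hz).2.2 _ ?_
      rw [hFz z hz, Real.sinh_arsinh]
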